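/- Let $\mathbb C_+=\{z\in\mathbb C:\operatorname{Im}z>0\}$. Let $\mathcal N_0$ be the Pick--Nevanlinna class, i.e. the class of functions $g$ holomorphic in $\mathbb C\setminus\mathbb R$ with $\operatorname{Im}g(z)\ge 0$ for $z\in\mathbb C_+$ and $g(\overline z)=\overline{g(z)}$ for $z\in\mathbb C\setminus\mathbb R$. For an integer $\kappa\ge 0$, let $\mathcal N_\kappa$ be the generalized Nevanlinna class: $f\in\mathcal N_\kappa$ if $f$ is meromorphic in $\mathbb C_+$, for all $n\ge1$ and all $z_1,\dots,z_n\in\mathbb C_+$ that are not poles of $f$ the Hermitian matrix $$H_f(z_1,\dots,z_n)=\left[\frac{f(z_k)-\overline{f(z_j)}}{z_k-\overline{z_j}}\right]_{k,j=1}^n$$ has at most $\kappa$ negative eigenvalues (counted with multiplicity), and for some choice of $n$ and $z_1,\dots,z_n$ it has exactly $\kappa$ of them. Let $g\in\mathcal N_0$, let $T$ be a rational function with real coefficients, put $f=Tg$ and $\mathcal I=\{t\in\mathbb R: T \text{ has no pole at } t \text{ and } T(t)<0\}$. Then $f\in\bigcup_{\kappa\ge0}\mathcal N_\kappa$ if and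 only if $g$ is analytic and real on $\mathcal I$ excluding at most a finite number of poles; that is, there is a finite set $S\subseteq\mathcal I$ such that $g$ continues analytically across every point of $\mathcal I\setminus S$, with a real value there, and continues meromorphically to a neighbourhood of every point of $S$, with a pole there. Moreover, if $f\in\mathcal N_\kappa$ for some $\kappa$, then $\mathcal I$ contains at most $\kappa$ poles of $g$, and likewise at most $\kappa$ poles of $f$ (on $\mathcal I$ these are the same points). -/

import Mathlib

open Filter Topology

noncomputable section

/-- The Pick--Nevanlinna class `𝒩₀`: `g` is holomorphic in `ℂ \ ℝ`, has nonnegative imaginary part in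
the upper half-plane, and satisfies `g (conj z) = conj (g z)`. The values of the Lean function `g` on
the real axis are irrelevant. -/
structure IsPickNevanlinna (g : ℂ → ℂ) : Prop where
  holomorphic : DifferentiableOn ℂ g {z : ℂ | z.im ≠ 0}
  im_nonneg : ∀ z : ℂ, 0 < z.im → 0 ≤ (g z).im
  symm : ∀ z : ℂ, z.im ≠ 0 → g (starRingEnd ℂ z) = starRingEnd ℂ (g z)

/-- The Pick matrix `H_f(z₁, …, zₙ)`. -/
def pickMatrix (f : ℂ → ℂ) {n : ℕ} (z : Fin n → ℂ) : Matrix (Fin n) (Fin n) ℂ :=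
  Matrix.of fun k j =>
    (f (z k) - starRingEnd ℂ (f (z j))) / (z k - starRingEnd ℂ (z j))

theorem pickMatrix_isHermitian (f : ℂ → ℂ) {n : ℕ} (z : Fin n → ℂ) :
    (pickMatrix f z).IsHermitian := by
  ext k j
  simp only [pickMatrix, Matrix.conjTranspose_apply, Matrix.of_apply, RCLike.star_def, map_div₀, map_sub,
    Complex.conj_conj]
  rw [← neg_sub (f (z k)), ← neg_sub (z k), neg_div_neg_eq]

/-- The number of negative squares of the Hermitian form of `H_f(z₁, …, zₙ)`, that is, the number of
negative eigenvalues counted with multiplicity. -/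
def negSquares (f : ℂ → ℂ) {n : ℕ} (z : Fin n → ℂ) : ℕ :=
  (Finset.univ.filter fun i => (pickMatrix_isHermitian f z).eigenvalues i < 0).card

/-- Admissible nodes: points of the upper half-plane at which `f` is holomorphic. (At a pole, or at a
removable singularity with a wrong value, the value of the Lean function `f` is meaningless.) -/
def AdmissibleNodes (f : ℂ → ℂ) {n : ℕ} (z : Fin n → ℂ) : Prop :=
  ∀ k, 0 < (z k).im ∧ AnalyticAt ℂ f (z k)

/-- The generalized Nevanlinna class `𝒩_κ`. -/
structure IsGenNevanlinna (κ : ℕ) (f : ℂ → ℂ) : Prop where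
  meromorphic : MeromorphicOn f {z : ℂ | 0 < z.im}
  negSquares_le : ∀ n : ℕ, 0 < n → ∀ z : Fin n → ℂ, AdmissibleNodes f z → negSquares f z ≤ κ
  exists_eq : ∃ n : ℕ, 0 < n ∧ ∃ z : Fin n → ℂ, AdmissibleNodes f z ∧ negSquares f z = κ

/-- The set `{t ∈ ℝ : -∞ < T(t) < 0}`; poles of `T` are excluded. -/
def negSet (T : RatFunc ℝ) : Set ℝ :=
  {t : ℝ | T.denom.eval t ≠ 0 ∧ T.eval (RingHom.id ℝ) t < 0}

/-- The function `f = T · g`. -/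
def ratMul (T : RatFunc ℝ) (g : ℂ → ℂ) : ℂ → ℂ :=
  fun z => T.eval (algebraMap ℝ ℂ) z * g z

/-- `g`, considered off the real axis, continues analytically across the real point `t`, with a real
value there. -/
def IsAnalyticRealAt (g : ℂ → ℂ) (t : ℝ) : Prop :=
  ∃ G : ℂ → ℂ, (∀ᶠ z in 𝓝 (t : ℂ), z.im ≠ 0 → G z = g z) ∧
    AnalyticAt ℂ G (t : ℂ) ∧ (G (t : ℂ)).im = 0

/-- `g`, considered off the real axis, continues meromorphically to a neighbourhood of the real point
`t`, and the continuation has a pole at `t`. -/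
def HasRealPoleAt (g : ℂ → ℂ) (t : ℝ) : Prop :=
  ∃ G : ℂ → ℂ, (∀ᶠ z in 𝓝 (t : ℂ), z.im ≠ 0 → G z = g z) ∧
    MeromorphicAt G (t : ℂ) ∧ meromorphicOrderAt G (t : ℂ) < 0

/-- `g` is analytic and real on `I` excluding at most a finite number of poles. -/
def AnalyticRealExceptFinitelyManyPoles (g : ℂ → ℂ) (I : Set ℝ) : Prop :=
  ∃ S : Set ℝ, S.Finite ∧ S ⊆ I ∧ (∀ t ∈ S, HasRealPoleAt g t) ∧
    ∀ t ∈ I \ S, IsAnalyticRealAt g t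

end

/-! Nevanlinna's representation gives g(z) = a + bz + ∫ (1 + tz)/(t - z) dν(t) with b ≥ 0 and ν a
finite positive measure. A real point is off supp ν exactly when g continues analytically across it
with a real value, and an isolated point of supp ν is a pole. Since I = `negSet T` is open, the
condition on g says that I ∩ supp ν is finite.

Necessity (`encard_negSet_inter_support_le`): near a point t of I ∩ supp ν the ratio k = Im g / Im z
is unbounded, while |g| is only O(√(k + 1)). As T is negative near t, the diagonal Pick entry Im f /
Im z is at most a negative multiple of k up to O(√(k + 1)), whereas entries joining nodes near
different points grow only like these square roots. With κ + 1 such points the diagonal wins and the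
Pick matrix is negative definite. So I ∩ supp ν has at most κ points, and it contains all the poles
to be counted.

Sufficiency (`negSquares_le_of_eval_ne_zero`): write T = A/M with a common factor vanishing at the
exceptional points, so that MA ≥ 0 on supp ν. Under N = deg M + deg A + 1 linear moment conditions
on the vector, all polynomial contributions vanish and the Pick form becomes ∫ (1 + t²) M A |∑ ξₖ/(t
- zₖ)|² dν ≥ 0. Hence there are never more than N negative eigenvalues. -/

/-! ### Herglotz–Riesz representation on the disc -/

open MeasureTheory Metric Real in
/-- **Schwarz integral formula** on the unit disc. -/
theorem circleAverage_schwarz {F : ℂ → ℂ} (hF : DiffContOnCl ℂ F (ball 0 1)) {ζ : ℂ}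
    (hζ : ζ ∈ ball (0 : ℂ) 1) :
    circleAverage (fun ω => (((F ω).im : ℝ) : ℂ) * ((ω + ζ) / (ω - ζ))) 0 1
      = -Complex.I * (F ζ - ((F 0).re : ℂ)) := by
  have hF' : DiffContOnCl ℂ F (ball 0 |1|) := by simpa using hF
  have hζ' : ζ ∈ ball (0 : ℂ) |1| := by simpa using hζ
  have hζ1 : ‖ζ‖ < 1 := by simpa using hζ
  have hcont : ContinuousOn F (sphere 0 1) := hF.2.mono <|
    sphere_subset_closedBall.trans_eq (closure_ball 0 one_ne_zero).symm
  have hne : ∀ ω ∈ sphere (0 : ℂ) 1, ω - ζ ≠ 0 := by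
    intro ω hω h
    have : ‖ω‖ = 1 := by simpa using hω
    rw [sub_eq_zero.1 h] at this
    linarith
  have h1 : circleAverage (fun ω => (ω / (ω - ζ)) * F ω) 0 1 = F ζ := by
    simpa using hF'.circleAverage_smul_div hζ'
  have h2 : circleAverage F 0 1 = F 0 := hF'.circleAverage
  -- On the circle the Schwarz kernel is the conjugate of (1 + ζ̄ω)/(1 - ζ̄ω), which is holomorphic
  -- in the disc. So the conj F half of Im F is handled by the mean value property of `H`, and the F
  -- half by Cauchy's formula.
  set H : ℂ → ℂ := fun ω => ((1 + starRingEnd ℂ ζ * ω) / (1 - starRingEnd ℂ ζ * ω)) * F ω with hH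
  have hne2 : ∀ ω ∈ closedBall (0 : ℂ) 1, 1 - starRingEnd ℂ ζ * ω ≠ 0 := by
    intro ω hω h
    have hω1 : ‖ω‖ ≤ 1 := by simpa using hω
    have h3 : ‖starRingEnd ℂ ζ * ω‖ = 1 := by rw [← sub_eq_zero.1 h]; simp
    rw [norm_mul, RCLike.norm_conj] at h3
    nlinarith [norm_nonneg ζ, norm_nonneg ω]
  have hHd : DiffContOnCl ℂ H (ball 0 |1|) := by
    apply DiffContOnCl.smul (c := fun ω => (1 + starRingEnd ℂ ζ * ω) / (1 - starRingEnd ℂ ζ * ω)) _ hF'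
    apply DifferentiableOn.diffContOnCl
    rw [abs_one, closure_ball 0 one_ne_zero]
    exact DifferentiableOn.div (by fun_prop) (by fun_prop) hne2
  have h3 : circleAverage H 0 1 = F 0 := by
    rw [hHd.circleAverage]; simp [hH]
  have hHc : CircleIntegrable H 0 1 := by
    apply ContinuousOn.circleIntegrable zero_le_one
    refine hHd.2.mono ?_
    rw [abs_one]
    exact sphere_subset_closedBall.trans_eq (closure_ball 0 one_ne_zero).symm
  have h4 : circleAverage (fun ω => starRingEnd ℂ (H ω)) 0 1 = starRingEnd ℂ (F 0) := by
    rw [← h3]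
    exact Complex.conjCLE.toContinuousLinearMap.circleAverage_comp_comm hHc
  have hi1 : CircleIntegrable (fun ω => (ω / (ω - ζ)) * F ω) 0 1 := by
    apply ContinuousOn.circleIntegrable zero_le_one
    exact (ContinuousOn.div (by fun_prop) (by fun_prop) hne).mul hcont
  have hi2 : CircleIntegrable F 0 1 := hcont.circleIntegrable zero_le_one
  have hi4 : CircleIntegrable (fun ω => starRingEnd ℂ (H ω)) 0 1 := by
    apply ContinuousOn.circleIntegrable zero_le_one
    refine Complex.continuous_conj.comp_continuousOn (hHd.2.mono ?_)
    rw [abs_one]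
    exact sphere_subset_closedBall.trans_eq (closure_ball 0 one_ne_zero).symm
  have key : Set.EqOn (fun ω => (((F ω).im : ℝ) : ℂ) * ((ω + ζ) / (ω - ζ)))
      ((-Complex.I / 2) • (((2 : ℂ) • (fun ω => (ω / (ω - ζ)) * F ω) - F) -
        fun ω => starRingEnd ℂ (H ω))) (sphere 0 |1|) := by
    intro ω hω
    rw [abs_one] at hω
    have hω1 : ‖ω‖ = 1 := by simpa using hω
    have hω2 : ω * starRingEnd ℂ ω = 1 := by
      rw [Complex.mul_conj, Complex.normSq_eq_norm_sq, hω1]; simp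
    have hne' := hne ω hω
    have hne3 := hne2 ω (sphere_subset_closedBall hω)
    have hne4 : 1 - ζ * starRingEnd ℂ ω ≠ 0 := by
      intro h
      apply hne3
      have := congrArg (starRingEnd ℂ) h
      simpa using this
    have e1 : starRingEnd ℂ (H ω) = ((ω + ζ) / (ω - ζ)) * starRingEnd ℂ (F ω) := by
      simp only [hH, map_mul, map_div₀, map_add, map_sub, map_one, Complex.conj_conj]
      congr 1
      rw [div_eq_div_iff hne4 hne']
      linear_combination (2 * ζ) * hω2
    have e2 : (((F ω).im : ℝ) : ℂ) = (-Complex.I / 2) * (F ω - starRingEnd ℂ (F ω)) := by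
      rw [Complex.sub_conj]
      push_cast
      linear_combination ((F ω).im : ℂ) * Complex.I_mul_I
    simp only [Pi.smul_apply, Pi.sub_apply, smul_eq_mul, e1, e2]
    field_simp
    ring
  rw [circleAverage_congr_sphere key, circleAverage_smul, circleAverage_sub, circleAverage_sub,
    circleAverage_smul, h1, h2, h4]
  · simp only [smul_eq_mul]
    have : ((F 0).re : ℂ) = (F 0 + starRingEnd ℂ (F 0)) / 2 := by rw [Complex.add_conj]; simp
    rw [this]; ring
  · exact hi1.const_smul
  · exact hi2
  · exact hi1.const_smul.sub hi2
  · exact hi4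

open MeasureTheory Metric Real in
/-- The boundary measure of a function holomorphic on the closed unit disc. -/
theorem exists_measure_sphere_of_diffContOnCl {F : ℂ → ℂ} (hF : DiffContOnCl ℂ F (ball 0 1))
    (him : ∀ ω ∈ sphere (0 : ℂ) 1, 0 ≤ (F ω).im) :
    ∃ μ : FiniteMeasure (sphere (0 : ℂ) 1), (μ.mass : ℝ) = (F 0).im ∧
      ∀ ζ ∈ ball (0 : ℂ) 1, F ζ = (F 0).re +
        Complex.I * ∫ ω, ((ω : ℂ) + ζ) / ((ω : ℂ) - ζ) ∂(μ : Measure (sphere (0 : ℂ) 1)) := by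
  have hcont : ContinuousOn F (sphere 0 1) := hF.2.mono <|
    sphere_subset_closedBall.trans_eq (closure_ball 0 one_ne_zero).symm
  have hmem : ∀ θ : ℝ, circleMap 0 1 θ ∈ sphere (0 : ℂ) 1 := circleMap_mem_sphere 0 zero_le_one
  set e : ℝ → sphere (0 : ℂ) 1 := fun θ => ⟨circleMap 0 1 θ, hmem θ⟩ with he
  have hec : Continuous e := by
    apply Continuous.subtype_mk
    exact continuous_circleMap 0 1
  set d : ℝ → ℝ := fun θ => (2 * π)⁻¹ * (F (circleMap 0 1 θ)).im with hd
  have hFc : Continuous fun θ => F (circleMap 0 1 θ) :=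
    hcont.comp_continuous (continuous_circleMap 0 1) hmem
  have hdc : Continuous d := continuous_const.mul (Complex.continuous_im.comp hFc)
  have hd0 : ∀ θ, 0 ≤ d θ := fun θ => mul_nonneg (by positivity) (him _ (hmem θ))
  set m : Measure ℝ := (volume.restrict (Set.Ioc 0 (2 * π))).withDensity
    (fun θ => ENNReal.ofReal (d θ)) with hm
  have hfin : IsFiniteMeasure m := by
    apply isFiniteMeasure_withDensity_ofReal
    have : IntegrableOn d (Set.Ioc 0 (2 * π)) :=
      (hdc.integrableOn_Icc (a := 0) (b := 2 * π)).mono_set Set.Ioc_subset_Icc_self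
    exact this.2
  have hint : ∀ K : ℂ → ℂ, ContinuousOn K (sphere 0 1) →
      ∫ ω, K ω ∂(m.map e) = circleAverage (fun ω => (((F ω).im : ℝ) : ℂ) * K ω) 0 1 := by
    intro K hK
    rw [integral_map hec.measurable.aemeasurable]
    · rw [hm, integral_withDensity_eq_integral_toReal_smul, circleAverage_def,
        intervalIntegral.integral_of_le two_pi_pos.le, ← integral_smul]
      · congr 1
        ext θ
        rw [ENNReal.toReal_ofReal (hd0 θ)]
        simp only [hd, he, Complex.real_smul]
        push_cast
        ring
      · exact hdc.measurable.ennreal_ofReal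
      · exact Eventually.of_forall fun _ => ENNReal.ofReal_lt_top
    · apply Continuous.aestronglyMeasurable
      exact hK.comp_continuous continuous_subtype_val fun x => x.2
  have hfm : IsFiniteMeasure (m.map e) := inferInstance
  refine ⟨⟨m.map e, hfm⟩, ?_, ?_⟩
  · have h1 := hint (fun _ => 1) continuousOn_const
    have h2 := circleAverage_schwarz hF (ζ := 0) (by simp)
    have h3 : circleAverage (fun ω => (((F ω).im : ℝ) : ℂ) * ((ω + 0) / (ω - 0))) 0 1 =
        circleAverage (fun ω => (((F ω).im : ℝ) : ℂ) * 1) 0 1 := by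
      apply circleAverage_congr_sphere
      intro ω hω
      have : ω ≠ 0 := by rintro rfl; simp at hω
      simp [this]
    rw [← h3, h2] at h1
    have h4 := congrArg Complex.re h1
    simp [measureReal_def] at h4
    exact h4
  · intro ζ hζ
    have hζ1 : ‖ζ‖ < 1 := by simpa using hζ
    have h1 := hint (fun ω => (ω + ζ) / (ω - ζ)) <| by
      apply ContinuousOn.div (by fun_prop) (by fun_prop)
      intro ω hω h
      have : ‖ω‖ = 1 := by simpa using hω
      rw [sub_eq_zero.1 h] at this
      linarith
    rw [circleAverage_schwarz hF hζ] at h1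
    simp only [FiniteMeasure.toMeasure_mk] at h1 ⊢
    rw [h1]
    linear_combination (F ζ - (F 0).re) * Complex.I_mul_I

open MeasureTheory Metric Real in
/-- **Herglotz–Riesz representation** on the unit disc. -/
theorem exists_herglotzRiesz {G : ℂ → ℂ} (hG : DifferentiableOn ℂ G (ball 0 1))
    (him : ∀ ζ ∈ ball (0 : ℂ) 1, 0 ≤ (G ζ).im) :
    ∃ μ : FiniteMeasure (sphere (0 : ℂ) 1), ∀ ζ ∈ ball (0 : ℂ) 1, G ζ = (G 0).re +
        Complex.I * ∫ ω, ((ω : ℂ) + ζ) / ((ω : ℂ) - ζ) ∂(μ : Measure (sphere (0 : ℂ) 1)) := by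
  set r : ℕ → ℝ := fun n => 1 - 1 / ((n : ℝ) + 1) with hr
  have hr0 : ∀ n, 0 ≤ r n := fun n => by
    have : 1 / ((n : ℝ) + 1) ≤ 1 := by
      rw [div_le_one (by positivity)]; linarith [(Nat.cast_nonneg n : (0 : ℝ) ≤ n)]
    simp only [hr]; linarith
  have hr1 : ∀ n, r n < 1 := fun n => by
    have : 0 < 1 / ((n : ℝ) + 1) := by positivity
    simp only [hr]; linarith
  have hrt : Tendsto r atTop (𝓝 1) := by
    have := tendsto_one_div_add_atTop_nhds_zero_nat (𝕜 := ℝ)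
    simpa [hr] using this.const_sub 1
  have hmem : ∀ n, ∀ ζ ∈ closedBall (0 : ℂ) 1, (r n : ℂ) * ζ ∈ ball (0 : ℂ) 1 := by
    intro n ζ hζ
    have hζ : ‖ζ‖ ≤ 1 := by simpa using hζ
    simp only [mem_ball_zero_iff, norm_mul, Complex.norm_real, norm_eq_abs, abs_of_nonneg (hr0 n)]
    nlinarith [hr0 n, hr1 n, norm_nonneg ζ]
  have hdiff : ∀ n, DiffContOnCl ℂ (fun ζ => G (r n * ζ)) (ball 0 1) := by
    intro n
    apply DifferentiableOn.diffContOnCl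
    rw [closure_ball 0 one_ne_zero]
    exact hG.comp (by fun_prop) (hmem n)
  choose μ hμ1 hμ2 using fun n => exists_measure_sphere_of_diffContOnCl (hdiff n)
    (fun ω hω => him _ (hmem n ω (sphere_subset_closedBall hω)))
  -- The boundary measures of the dilates all have mass Im G(0), hence lie in a weakly compact set;
  -- an ultrafilter limit replaces a convergent subsequence.
  set U := hyperfilter ℕ
  obtain ⟨ν, -, hν⟩ := (isCompact_setOfPred_finiteMeasure_le_of_compactSpace
    (sphere (0 : ℂ) 1) (Real.toNNReal (G 0).im)).ultrafilter_le_nhds (U.map μ) (by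
      rw [le_principal_iff]
      refine Filter.mem_map.2 (Filter.univ_mem' fun n => ?_)
      change (μ n).mass ≤ _
      rw [← NNReal.coe_le_coe, hμ1, Real.coe_toNNReal']
      simp)
  have hν' : Tendsto μ U (𝓝 ν) := hν
  refine ⟨ν, fun ζ hζ => ?_⟩
  have hζ1 : ‖ζ‖ < 1 := by simpa using hζ
  have hne : ∀ ω : sphere (0 : ℂ) 1, (ω : ℂ) - ζ ≠ 0 := by
    intro ω h
    have : ‖(ω : ℂ)‖ = 1 := by simp
    rw [sub_eq_zero.1 h] at this
    linarith
  rw [FiniteMeasure.tendsto_iff_forall_integral_rclike_tendsto ℂ] at hν'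
  have h1 := hν' (BoundedContinuousFunction.mkOfCompact
    ⟨fun ω : sphere (0 : ℂ) 1 => ((ω : ℂ) + ζ) / ((ω : ℂ) - ζ),
      Continuous.div (by fun_prop) (by fun_prop) hne⟩)
  simp only [BoundedContinuousFunction.mkOfCompact_apply, ContinuousMap.coe_mk] at h1
  have h2 : Tendsto (fun n => G (r n * ζ)) U (𝓝 (G ζ)) := by
    have hc : ContinuousAt G ζ := (hG.differentiableAt (isOpen_ball.mem_nhds hζ)).continuousAt
    have h3 : Tendsto (fun n => (r n : ℂ) * ζ) atTop (𝓝 ζ) := by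
      have := ((Complex.continuous_ofReal.tendsto 1).comp hrt).mul_const ζ
      simpa using this
    exact (hc.tendsto.comp h3).mono_left Nat.hyperfilter_le_atTop
  have h4 : Tendsto (fun n => G (r n * ζ)) U (𝓝 ((G 0).re + Complex.I *
      ∫ ω, ((ω : ℂ) + ζ) / ((ω : ℂ) - ζ) ∂(ν : Measure (sphere (0 : ℂ) 1)))) := by
    have := (h1.const_mul Complex.I).const_add ((G 0).re : ℂ)
    refine this.congr fun n => ?_
    have := hμ2 n ζ hζ
    simp only [mul_zero] at this
    exact this.symm
  exact tendsto_nhds_unique h2 h4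

/-! ### Nevanlinna's representation on the half-plane -/

open MeasureTheory in
/-- Nevanlinna's integral representation with data `a`, `b`, `ν`. -/
structure NevanlinnaRep (g : ℂ → ℂ) (a b : ℝ) (ν : Measure ℝ) : Prop where
  nonneg : 0 ≤ b
  finite : IsFiniteMeasure ν
  eq : ∀ z : ℂ, z.im ≠ 0 → g z = a + b * z + ∫ t : ℝ, (1 + t * z) / (t - z) ∂ν

theorem cayley_im_pos {ζ : ℂ} (hζ : ‖ζ‖ < 1) : 0 < (Complex.I * (1 + ζ) / (1 - ζ)).im := by
  have h1 : 1 - ζ ≠ 0 := by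
    intro h
    rw [← sub_eq_zero.1 h] at hζ
    simp at hζ
  have h2 : 0 < Complex.normSq (1 - ζ) := Complex.normSq_pos.2 h1
  have h3 : Complex.normSq ζ < 1 := by
    rw [Complex.normSq_eq_norm_sq]
    nlinarith [norm_nonneg ζ]
  have h4 : (Complex.I * (1 + ζ) / (1 - ζ)).im
      = (1 - Complex.normSq ζ) / Complex.normSq (1 - ζ) := by
    rw [Complex.div_im]
    simp only [Complex.normSq_apply, Complex.mul_re, Complex.mul_im, Complex.add_re, Complex.add_im,
      Complex.sub_re, Complex.sub_im, Complex.I_re, Complex.I_im, Complex.one_re, Complex.one_im]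
    rw [← sub_div]
    congr 1
    ring
  rw [h4]
  exact div_pos (by linarith) h2

theorem cayley_ofReal {ω : ℂ} (hω : ‖ω‖ = 1) (h1 : ω ≠ 1) :
    (((Complex.I * (1 + ω) / (1 - ω)).re : ℝ) : ℂ) = Complex.I * (1 + ω) / (1 - ω) := by
  rw [← Complex.conj_eq_iff_re]
  have hω2 : ω * starRingEnd ℂ ω = 1 := by
    rw [Complex.mul_conj, Complex.normSq_eq_norm_sq, hω]; simp
  have h2 : 1 - ω ≠ 0 := sub_ne_zero.2 h1.symm
  have h3 : 1 - starRingEnd ℂ ω ≠ 0 := by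
    intro h
    apply h2
    have := congrArg (starRingEnd ℂ) h
    simpa using this
  simp only [map_div₀, map_mul, map_add, map_sub, map_one, Complex.conj_I]
  rw [div_eq_div_iff h3 h2]
  linear_combination 2 * Complex.I * hω2

open MeasureTheory Metric in
theorem norm_cauchyKernel_le {z : ℂ} (hz : z.im ≠ 0) (t : ℝ) : ‖((t : ℂ) - z)⁻¹‖ ≤ |z.im|⁻¹ := by
  rw [norm_inv]
  apply inv_anti₀ (abs_pos.2 hz)
  have := Complex.abs_im_le_norm ((t : ℂ) - z)
  simpa using this

-- The Cayley map transports the disc representation. The atom at ω = 1, the preimage of ∞, yields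
-- the coefficient b; the rest of the measure is pushed to the line. Symmetry covers the lower
-- half-plane.
open MeasureTheory Metric in
theorem IsPickNevanlinna.exists_rep {g : ℂ → ℂ} (hg : IsPickNevanlinna g) :
    ∃ (a b : ℝ) (ν : Measure ℝ), NevanlinnaRep g a b ν := by
  set c : ℂ → ℂ := fun ζ => Complex.I * (1 + ζ) / (1 - ζ) with hc
  have hne : ∀ ζ ∈ ball (0 : ℂ) 1, 1 - ζ ≠ 0 := by
    intro ζ hζ h
    rw [← sub_eq_zero.1 h] at hζ
    simp at hζ
  have hcim : ∀ ζ ∈ ball (0 : ℂ) 1, 0 < (c ζ).im := fun ζ hζ => cayley_im_pos (by simpa using hζ)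
  have hG : DifferentiableOn ℂ (fun ζ => g (c ζ)) (ball 0 1) := by
    refine hg.holomorphic.comp ?_ fun ζ hζ => (hcim ζ hζ).ne'
    exact DifferentiableOn.div (by fun_prop) (by fun_prop) hne
  obtain ⟨μ, hμ⟩ := exists_herglotzRiesz hG fun ζ hζ => hg.im_nonneg _ (hcim ζ hζ)
  set m : Measure (sphere (0 : ℂ) 1) := μ.toMeasure with hm
  set one : sphere (0 : ℂ) 1 := ⟨1, by simp⟩ with hone
  set τ : sphere (0 : ℂ) 1 → ℝ := fun ω => (c ω).re with hτ
  have hτm : Measurable τ := by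
    apply Complex.measurable_re.comp
    have : Measurable c := by
      simp only [hc]
      fun_prop
    exact this.comp measurable_subtype_coe
  set ν : Measure ℝ := (m.restrict {one}ᶜ).map τ with hν
  have hνf : IsFiniteMeasure ν := inferInstance
  have upper : ∀ z : ℂ, 0 < z.im → g z = ((g (c 0)).re : ℝ) + (m.real {one} : ℝ) * z +
      ∫ t : ℝ, (1 + t * z) / (t - z) ∂ν := by
    intro z hz
    have hzI : z + Complex.I ≠ 0 := by
      intro h
      have := congrArg Complex.im h
      simp at this
      linarith
    set ζ : ℂ := (z - Complex.I) / (z + Complex.I) with hζdef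
    have hζ1 : 1 - ζ ≠ 0 := by
      have : 1 - ζ = 2 * Complex.I / (z + Complex.I) := by
        rw [hζdef]; field_simp; ring
      rw [this]
      exact div_ne_zero (by simp) hzI
    have hcζ : c ζ = z := by
      simp only [hc]
      rw [div_eq_iff hζ1, hζdef]
      field_simp
      ring
    have hζ : ζ ∈ ball (0 : ℂ) 1 := by
      rw [mem_ball_zero_iff, hζdef, norm_div, div_lt_one (norm_pos_iff.2 hzI)]
      rw [← abs_of_nonneg (norm_nonneg (z - Complex.I)), ← abs_of_nonneg (norm_nonneg (z + Complex.I)),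
        ← sq_lt_sq, ← Complex.normSq_eq_norm_sq, ← Complex.normSq_eq_norm_sq]
      simp only [Complex.normSq_apply, Complex.add_re, Complex.add_im, Complex.sub_re,
        Complex.sub_im, Complex.I_re, Complex.I_im]
      nlinarith
    have hζn : ‖ζ‖ < 1 := by simpa using hζ
    have hωζ : ∀ ω : sphere (0 : ℂ) 1, (ω : ℂ) - ζ ≠ 0 := by
      intro ω h
      have : ‖(ω : ℂ)‖ = 1 := by simp
      rw [sub_eq_zero.1 h] at this
      linarith
    have hK : Continuous fun ω : sphere (0 : ℂ) 1 => ((ω : ℂ) + ζ) / ((ω : ℂ) - ζ) :=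
      Continuous.div (by fun_prop) (by fun_prop) hωζ
    have hKi : Integrable (fun ω : sphere (0 : ℂ) 1 => ((ω : ℂ) + ζ) / ((ω : ℂ) - ζ)) m :=
      hK.integrable_of_hasCompactSupport (HasCompactSupport.of_compactSpace _)
    have h1 := hμ ζ hζ
    rw [← integral_add_compl (measurableSet_singleton one) hKi, integral_singleton] at h1
    simp only [hcζ] at h1
    rw [h1, hν, integral_map hτm.aemeasurable]
    -- With τ = i(1+ω)/(1-ω) and z = i(1+ζ)/(1-ζ) one has i(ω+ζ)/(ω-ζ) = (1+τz)/(τ-z).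
    · have h2 : Complex.I * ∫ ω in ({one}ᶜ : Set (sphere (0 : ℂ) 1)),
          ((ω : ℂ) + ζ) / ((ω : ℂ) - ζ) ∂m =
          ∫ ω in ({one}ᶜ : Set (sphere (0 : ℂ) 1)), (1 + (τ ω : ℂ) * z) / ((τ ω : ℂ) - z) ∂m := by
        rw [← integral_const_mul]
        refine setIntegral_congr_fun (measurableSet_singleton one).compl fun ω hω => ?_
        have hω1 : (ω : ℂ) ≠ 1 := fun h => hω (Subtype.ext h)
        have h3 : (τ ω : ℂ) = c ω := cayley_ofReal (by simp) hω1
        have h4 : (τ ω : ℂ) - z ≠ 0 := by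
          intro h
          have := congrArg Complex.im h
          simp at this
          exact hz.ne' this
        have h5 : (1 : ℂ) - ω ≠ 0 := sub_ne_zero.2 hω1.symm
        have h6 : (τ ω : ℂ) * (1 - ω) = Complex.I * (1 + ω) := by
          rw [h3]; simp only [hc]; field_simp
        have h7 : ζ * (z + Complex.I) = z - Complex.I := by
          rw [hζdef]; field_simp
        have h8 : z * (1 - ζ) = Complex.I * (1 + ζ) := by linear_combination -h7
        rw [← mul_div_assoc, div_eq_div_iff (hωζ ω) h4]
        apply mul_right_cancel₀ (mul_ne_zero h5 hζ1)
        linear_combination Complex.I * (ω + ζ) * ((1 - ζ) * h6 - (1 - ω) * h8) -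
          (ω - ζ) * (z * (1 - ζ) * h6 + Complex.I * (1 + ω) * h8) +
          (ω - ζ) * (2 * (ω + ζ) - (1 + ω) * (1 + ζ)) * Complex.I_mul_I
      rw [mul_add, h2]
      have h9 : Complex.I * ((1 + ζ) / (1 - ζ)) = z := by
        rw [← mul_div_assoc]; exact hcζ
      simp only [hone, Complex.real_smul]
      linear_combination ((m.real {one} : ℝ) : ℂ) * h9
    · apply Measurable.aestronglyMeasurable
      fun_prop
  refine ⟨(g (c 0)).re, m.real {one}, ν, measureReal_nonneg, hνf, fun z hz => ?_⟩
  rcases lt_or_gt_of_ne hz with h | h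
  · have h1 := upper (starRingEnd ℂ z) (by simpa using h)
    rw [hg.symm z hz] at h1
    have h2 := congrArg (starRingEnd ℂ) h1
    rw [Complex.conj_conj] at h2
    rw [h2, map_add, ← integral_conj]
    simp
  · exact upper z h

/-! ### Kernel estimates and growth of g -/

theorem ofReal_sub_ne_zero {z : ℂ} (hz : z.im ≠ 0) (t : ℝ) : (t : ℂ) - z ≠ 0 := by
  intro h
  have := congrArg Complex.im h
  simp at this
  exact hz this

theorem nevanlinnaKernel_eq {z : ℂ} {t : ℝ} (h : (t : ℂ) - z ≠ 0) :
    (1 + t * z) / ((t : ℂ) - z) = z + (1 + z ^ 2) * ((t : ℂ) - z)⁻¹ := by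
  field_simp
  ring

theorem nevanlinnaKernel_im (z : ℂ) (t : ℝ) :
    ((1 + t * z) / ((t : ℂ) - z)).im = z.im * ((1 + t ^ 2) / Complex.normSq ((t : ℂ) - z)) := by
  rw [Complex.div_im]
  simp only [Complex.add_re, Complex.add_im, Complex.mul_re, Complex.mul_im, Complex.sub_re,
    Complex.sub_im, Complex.ofReal_re, Complex.ofReal_im, Complex.one_re, Complex.one_im]
  ring

/-- Cauchy–Schwarz for 1 + tz. The bound is a multiple of the Poisson kernel, whose integral is Im g
/ Im z - b. -/
theorem nevanlinnaKernel_normSq_le (z : ℂ) (t : ℝ) :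
    Complex.normSq ((1 + t * z) / ((t : ℂ) - z)) ≤
      (1 + Complex.normSq z) * ((1 + t ^ 2) / Complex.normSq ((t : ℂ) - z)) := by
  rw [Complex.normSq_div, ← mul_div_assoc]
  apply div_le_div_of_nonneg_right _ (Complex.normSq_nonneg _)
  simp only [Complex.normSq_apply, Complex.add_re, Complex.add_im, Complex.mul_re, Complex.mul_im,
    Complex.ofReal_re, Complex.ofReal_im, Complex.one_re, Complex.one_im]
  nlinarith [sq_nonneg (t - z.re), sq_nonneg z.im]

open MeasureTheory

theorem integrable_cauchyKernel {z : ℂ} (hz : z.im ≠ 0) (ν : Measure ℝ) [IsFiniteMeasure ν] :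
    Integrable (fun t : ℝ => ((t : ℂ) - z)⁻¹) ν := by
  apply Integrable.of_bound (C := |z.im|⁻¹)
  · apply Measurable.aestronglyMeasurable
    fun_prop
  · exact Eventually.of_forall (norm_cauchyKernel_le hz)

theorem integrable_nevanlinnaKernel {z : ℂ} (hz : z.im ≠ 0) (ν : Measure ℝ) [IsFiniteMeasure ν] :
    Integrable (fun t : ℝ => (1 + t * z) / ((t : ℂ) - z)) ν := by
  simp_rw [nevanlinnaKernel_eq (ofReal_sub_ne_zero hz _)]
  exact (integrable_const z).add ((integrable_cauchyKernel hz ν).const_mul _)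

theorem integrable_poissonKernel {z : ℂ} (hz : z.im ≠ 0) (ν : Measure ℝ) [IsFiniteMeasure ν] :
    Integrable (fun t : ℝ => (1 + t ^ 2) / Complex.normSq ((t : ℂ) - z)) ν := by
  have h := (integrable_nevanlinnaKernel hz ν).im.const_mul z.im⁻¹
  refine h.congr (Eventually.of_forall fun t => ?_)
  change z.im⁻¹ * ((1 + t * z) / ((t : ℂ) - z)).im = _
  rw [nevanlinnaKernel_im, inv_mul_cancel_left₀ hz]

namespace NevanlinnaRep

variable {g : ℂ → ℂ} {a b : ℝ} {ν : Measure ℝ}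

theorem eq_cauchy (h : NevanlinnaRep g a b ν) {z : ℂ} (hz : z.im ≠ 0) :
    g z = a + (b + ν.real Set.univ : ℝ) * z + (1 + z ^ 2) * ∫ t : ℝ, ((t : ℂ) - z)⁻¹ ∂ν := by
  have := h.finite
  rw [h.eq z hz]
  simp_rw [nevanlinnaKernel_eq (ofReal_sub_ne_zero hz _)]
  rw [integral_add (integrable_const z) ((integrable_cauchyKernel hz ν).const_mul _),
    integral_const_mul, integral_const]
  simp only [Complex.real_smul]
  push_cast
  ring

theorem im_eq (h : NevanlinnaRep g a b ν) {z : ℂ} (hz : z.im ≠ 0) :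
    (g z).im = z.im * (b + ∫ t : ℝ, (1 + t ^ 2) / Complex.normSq ((t : ℂ) - z) ∂ν) := by
  have := h.finite
  rw [h.eq z hz, Complex.add_im]
  have h1 : (∫ t : ℝ, (1 + t * z) / ((t : ℂ) - z) ∂ν).im =
      ∫ t : ℝ, ((1 + t * z) / ((t : ℂ) - z)).im ∂ν :=
    (Complex.imCLM.integral_comp_comm (integrable_nevanlinnaKernel hz ν)).symm
  rw [h1]
  simp_rw [nevanlinnaKernel_im]
  rw [integral_const_mul]
  simp
  ring

theorem symm (h : NevanlinnaRep g a b ν) {z : ℂ} (hz : z.im ≠ 0) :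
    g (starRingEnd ℂ z) = starRingEnd ℂ (g z) := by
  have := h.finite
  rw [h.eq z hz, h.eq _ (by simpa using hz), map_add, ← integral_conj]
  simp

theorem poisson_nonneg (z : ℂ) :
    0 ≤ ∫ t : ℝ, (1 + t ^ 2) / Complex.normSq ((t : ℂ) - z) ∂ν :=
  integral_nonneg fun t => div_nonneg (by positivity) (Complex.normSq_nonneg _)

theorem im_div_nonneg (h : NevanlinnaRep g a b ν) {z : ℂ} (hz : z.im ≠ 0) :
    0 ≤ (g z).im / z.im := by
  rw [h.im_eq hz, mul_div_cancel_left₀ _ hz]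
  exact add_nonneg h.nonneg (poisson_nonneg z)

/-- The size of g is controlled by the square root of Im g / Im z; this gain is what lets diagonal
Pick entries beat off-diagonal ones. The added 1 keeps the root positive. -/
theorem norm_le (h : NevanlinnaRep g a b ν) {z : ℂ} (hz : z.im ≠ 0) :
    ‖g z‖ ≤ |a| + b * ‖z‖ +
      (ν.real Set.univ + 1 + Complex.normSq z) / 2 * √((g z).im / z.im + 1) := by
  have := h.finite
  set k := (g z).im / z.im with hk
  have hk0 : 0 ≤ k := h.im_div_nonneg hz
  set s := √(k + 1) with hs
  have hs0 : 0 < s := Real.sqrt_pos.2 (by linarith)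
  have hs2 : s * s = k + 1 := Real.mul_self_sqrt (by linarith)
  have hP : ∫ t : ℝ, (1 + t ^ 2) / Complex.normSq ((t : ℂ) - z) ∂ν ≤ s * s := by
    rw [hs2, hk, h.im_eq hz, mul_div_cancel_left₀ _ hz]
    linarith [h.nonneg]
  -- AM–GM with weight s: x ≤ s/2 + x²/(2s), where x² is bounded by the Poisson kernel, whose
  -- integral is at most s².
  have h1 : ‖∫ t : ℝ, (1 + t * z) / ((t : ℂ) - z) ∂ν‖ ≤
      ∫ t : ℝ, (s / 2 + (1 + Complex.normSq z) / (2 * s) *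
        ((1 + t ^ 2) / Complex.normSq ((t : ℂ) - z))) ∂ν := by
    refine (norm_integral_le_integral_norm _).trans (integral_mono
      (integrable_nevanlinnaKernel hz ν).norm
      ((integrable_const _).add ((integrable_poissonKernel hz ν).const_mul _)) fun t => ?_)
    have h2 := nevanlinnaKernel_normSq_le z t
    rw [Complex.normSq_eq_norm_sq ((1 + t * z) / ((t : ℂ) - z))] at h2
    set x := ‖(1 + t * z) / ((t : ℂ) - z)‖
    set y := (1 + t ^ 2) / Complex.normSq ((t : ℂ) - z)
    have h3 : s / 2 + (1 + Complex.normSq z) / (2 * s) * y =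
        (s * s + (1 + Complex.normSq z) * y) / (2 * s) := by field_simp
    change x ≤ _
    rw [h3, le_div_iff₀ (by positivity)]
    nlinarith [sq_nonneg (x - s)]
  rw [integral_add (integrable_const _) ((integrable_poissonKernel hz ν).const_mul _),
    integral_const_mul, integral_const, smul_eq_mul] at h1
  have h4 : (1 + Complex.normSq z) / (2 * s) *
      ∫ t : ℝ, (1 + t ^ 2) / Complex.normSq ((t : ℂ) - z) ∂ν ≤
      (1 + Complex.normSq z) / (2 * s) * (s * s) := by
    apply mul_le_mul_of_nonneg_left hP
    have := Complex.normSq_nonneg z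
    positivity
  have h5 : (1 + Complex.normSq z) / (2 * s) * (s * s) = (1 + Complex.normSq z) / 2 * s := by
    field_simp
  rw [h.eq z hz]
  refine (norm_add_le _ _).trans ?_
  have h6 : ‖(a : ℂ) + b * z‖ ≤ |a| + b * ‖z‖ := by
    refine (norm_add_le _ _).trans ?_
    rw [norm_mul, Complex.norm_real, Complex.norm_real, Real.norm_eq_abs, Real.norm_eq_abs,
      abs_of_nonneg h.nonneg]
  linarith

/-- On the interval |t - z|² ≤ 2y², so the Poisson kernel is at least 1/(2y²) there. -/
theorem measureReal_Icc_le (h : NevanlinnaRep g a b ν) (x : ℝ) {y : ℝ} (hy : 0 < y) :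
    ν.real (Set.Icc (x - y) (x + y)) ≤ 2 * y * (g (x + y * Complex.I)).im := by
  have := h.finite
  set z : ℂ := x + y * Complex.I with hz
  have hzi : z.im = y := by simp [hz]
  have hz0 : z.im ≠ 0 := by rw [hzi]; exact hy.ne'
  have h1 : ν.real (Set.Icc (x - y) (x + y)) * (1 / (2 * y ^ 2)) ≤
      ∫ t : ℝ, (1 + t ^ 2) / Complex.normSq ((t : ℂ) - z) ∂ν := by
    rw [← smul_eq_mul, ← integral_indicator_const _ measurableSet_Icc]
    apply integral_mono ((integrable_const _).indicator measurableSet_Icc)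
      (integrable_poissonKernel hz0 ν)
    intro t
    by_cases ht : t ∈ Set.Icc (x - y) (x + y)
    · rw [Set.indicator_of_mem ht]
      have hpos : 0 < Complex.normSq ((t : ℂ) - z) :=
        Complex.normSq_pos.2 (ofReal_sub_ne_zero hz0 t)
      refine div_le_div₀ (by positivity) (by nlinarith) hpos ?_
      have : Complex.normSq ((t : ℂ) - z) = (t - x) ^ 2 + y ^ 2 := by
        simp [Complex.normSq_apply, hz]; ring
      rw [this]
      nlinarith [ht.1, ht.2]
    · rw [Set.indicator_of_notMem ht]
      exact div_nonneg (by positivity) (Complex.normSq_nonneg _)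
  rw [h.im_eq hz0, hzi]
  have h2 := h.nonneg
  rw [mul_one_div, div_le_iff₀ (by positivity)] at h1
  nlinarith [mul_nonneg h2 (sq_nonneg y)]

/-! ### Support of ν versus continuation of g -/

/-- If `Im g ≤ C Im z` near the real point `t₀`, then `ν` vanishes near `t₀`. -/
theorem notMem_support_of_im_le (h : NevanlinnaRep g a b ν) {t₀ C : ℝ}
    (hC : ∀ᶠ z : ℂ in 𝓝 (t₀ : ℂ), 0 < z.im → (g z).im ≤ C * z.im) : t₀ ∉ ν.support := by
  have := h.finite
  obtain ⟨ε, hε, hball⟩ := Metric.eventually_nhds_iff.1 hC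
  -- The mass of an interval of radius y is at most 2Cy². Halving the interval gives two pieces with
  -- a quarter of this bound each, so every bisection gains a factor 1/2.
  have key : ∀ n : ℕ, ∀ x y : ℝ, 0 < y → |x - t₀| + y < ε →
      ν.real (Set.Icc (x - y) (x + y)) ≤ 2 * C * y ^ 2 / 2 ^ n := by
    intro n
    induction n with
    | zero =>
      intro x y hy hxy
      have h1 := h.measureReal_Icc_le x hy
      have h2 := @hball (x + y * Complex.I) (by
        rw [dist_eq_norm]
        have : (x : ℂ) + y * Complex.I - t₀ = ((x - t₀ : ℝ) : ℂ) + y * Complex.I := by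
          push_cast; ring
        rw [this]
        refine (norm_add_le _ _).trans_lt ?_
        rwa [norm_mul, Complex.norm_I, mul_one, Complex.norm_real, Complex.norm_real,
          Real.norm_eq_abs, Real.norm_eq_abs, abs_of_pos hy]) (by simpa using hy)
      have h3 : ((x : ℂ) + y * Complex.I).im = y := by simp
      rw [h3] at h2
      simp only [pow_zero, div_one]
      nlinarith
    | succ n ih =>
      intro x y hy hxy
      have hsub : Set.Icc (x - y) (x + y) ⊆ Set.Icc (x - y / 2 - y / 2) (x - y / 2 + y / 2) ∪
          Set.Icc (x + y / 2 - y / 2) (x + y / 2 + y / 2) := by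
        intro t ht
        rcases le_total t x with h1 | h1
        · left; constructor <;> linarith [ht.1, ht.2]
        · right; constructor <;> linarith [ht.1, ht.2]
      have h1 := ih (x - y / 2) (y / 2) (by linarith) (by
        have := abs_sub_abs_le_abs_sub (x - y / 2 - t₀) (x - t₀)
        have h2 : |x - y / 2 - t₀ - (x - t₀)| = y / 2 := by
          rw [show x - y / 2 - t₀ - (x - t₀) = -(y / 2) by ring, abs_neg, abs_of_pos (by linarith)]
        linarith)
      have h2 := ih (x + y / 2) (y / 2) (by linarith) (by
        have := abs_sub_abs_le_abs_sub (x + y / 2 - t₀) (x - t₀)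
        have h2 : |x + y / 2 - t₀ - (x - t₀)| = y / 2 := by
          rw [show x + y / 2 - t₀ - (x - t₀) = y / 2 by ring, abs_of_pos (by linarith)]
        linarith)
      have h3 : 2 * C * (y / 2) ^ 2 / 2 ^ n + 2 * C * (y / 2) ^ 2 / 2 ^ n =
          2 * C * y ^ 2 / 2 ^ (n + 1) := by
        rw [pow_succ]; field_simp; ring
      rw [← h3]
      exact ((measureReal_mono hsub).trans (measureReal_union_le _ _)).trans (add_le_add h1 h2)
  rw [Measure.notMem_support_iff_exists]
  refine ⟨Set.Icc (t₀ - ε / 2) (t₀ + ε / 2), Icc_mem_nhds (by linarith) (by linarith), ?_⟩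
  have h1 : Tendsto (fun n : ℕ => 2 * C * (ε / 2) ^ 2 / 2 ^ n) atTop (𝓝 0) := by
    apply Tendsto.const_div_atTop
    exact tendsto_pow_atTop_atTop_of_one_lt one_lt_two
  have h2 : ν.real (Set.Icc (t₀ - ε / 2) (t₀ + ε / 2)) ≤ 0 :=
    ge_of_tendsto' h1 fun n => key n t₀ (ε / 2) (by linarith) (by simp; linarith)
  exact (measureReal_eq_zero_iff).1 (le_antisymm h2 measureReal_nonneg)

/-- The right side of `eq_cauchy` is analytic off the support, and real at real points because its
integrand is. -/
theorem isAnalyticRealAt_of_notMem_support (h : NevanlinnaRep g a b ν) {t₀ : ℝ}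
    (ht : t₀ ∉ ν.support) : IsAnalyticRealAt g t₀ := by
  have := h.finite
  refine ⟨fun z => a + (b + ν.real Set.univ : ℝ) * z + (1 + z ^ 2) * resolventTransform ν z,
    ?_, ?_, ?_⟩
  · refine Eventually.of_forall fun z hz => ?_
    beta_reduce
    rw [h.eq_cauchy hz, resolventTransform_apply]
    simp [resolvent]
  · have h1 : (t₀ : ℂ) ∉ algebraMap ℝ ℂ '' ν.support := by
      rintro ⟨t, ht', h2⟩
      have : t = t₀ := by simpa using h2
      exact ht (this ▸ ht')
    have h2 : IsOpen (algebraMap ℝ ℂ '' ν.support)ᶜ := by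
      rw [isOpen_compl_iff]
      exact (algebraMap_isometry ℝ ℂ).isClosedEmbedding.isClosedMap _ Measure.isClosed_support
    have h3 : AnalyticAt ℂ (resolventTransform ν : ℂ → ℂ) (t₀ : ℂ) :=
      (h2.analyticOn_iff_analyticOnNhd.1 analyticOn_resolventTransform) _ h1
    fun_prop
  · have h1 : resolventTransform ν (t₀ : ℂ) = ((∫ t : ℝ, (t - t₀)⁻¹ ∂ν : ℝ) : ℂ) := by
      rw [resolventTransform_apply, ← integral_complex_ofReal]
      congr 1
      ext t
      simp [resolvent]
    beta_reduce
    rw [h1]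
    have : (a : ℂ) + (b + ν.real Set.univ : ℝ) * t₀ + (1 + (t₀ : ℂ) ^ 2) *
        ((∫ t : ℝ, (t - t₀)⁻¹ ∂ν : ℝ) : ℂ) =
        ((a + (b + ν.real Set.univ) * t₀ + (1 + t₀ ^ 2) * ∫ t : ℝ, (t - t₀)⁻¹ ∂ν : ℝ) : ℂ) := by
      push_cast; ring
    rw [this, Complex.ofReal_im]

/-- An isolated point of the support of `ν` is a pole of `g`. -/
theorem hasRealPoleAt_of_isolated (h : NevanlinnaRep g a b ν) {t₀ : ℝ}
    (ht : t₀ ∈ ν.support) (hiso : ∀ᶠ t in 𝓝[≠] t₀, t ∉ ν.support) : HasRealPoleAt g t₀ := by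
  have := h.finite
  set ν' := ν.restrict {t₀}ᶜ with hν'
  set m := ν.real {t₀} with hm
  obtain ⟨U, hU, hUs⟩ := eventually_iff_exists_mem.1 (eventually_nhdsWithin_iff.1 hiso)
  have hU0 : ν (U \ {t₀}) = 0 :=
    measure_mono_null (fun t ht => hUs t ht.1 ht.2) Measure.measure_compl_support
  -- An isolated point of the support must be an atom.
  have hm0 : m ≠ 0 := by
    intro h0
    have h1 : ν {t₀} = 0 := (measureReal_eq_zero_iff).1 h0
    refine (Measure.mem_support_iff_forall t₀).1 ht U hU |>.ne' ?_
    refine measure_mono_null (fun t ht => ?_) (measure_union_null hU0 h1)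
    by_cases h2 : t = t₀
    · exact Or.inr h2
    · exact Or.inl ⟨ht, h2⟩
  have ht' : t₀ ∉ ν'.support := by
    rw [Measure.notMem_support_iff_exists]
    refine ⟨U, hU, ?_⟩
    rw [hν', Measure.restrict_apply' (measurableSet_singleton t₀).compl]
    exact hU0
  have hrep : NevanlinnaRep (fun z => a + b * z + ∫ t : ℝ, (1 + t * z) / (t - z) ∂ν') a b ν' :=
    ⟨h.nonneg, inferInstance, fun _ _ => rfl⟩
  obtain ⟨G, hG1, hG2, -⟩ := hrep.isAnalyticRealAt_of_notMem_support ht'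
  -- The atom gives a term whose numerator tends to m(1 + t₀²) ≠ 0; the rest of ν has t₀ off its
  -- support and contributes the analytic `G`.
  refine ⟨fun z => m * ((1 + t₀ * z) / (t₀ - z)) + G z, ?_, ?_, ?_⟩
  · filter_upwards [hG1] with z hz hz0
    rw [hz hz0, h.eq z hz0,
      ← integral_add_compl (measurableSet_singleton t₀) (integrable_nevanlinnaKernel hz0 ν),
      integral_singleton]
    simp only [Complex.real_smul, ← hν', ← hm]
    ring
  · have : AnalyticAt ℂ (fun z : ℂ => 1 + t₀ * z) t₀ := by fun_prop
    have h2 : AnalyticAt ℂ (fun z : ℂ => t₀ - z) t₀ := by fun_prop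
    have h3 : AnalyticAt ℂ (fun _ : ℂ => (m : ℂ)) t₀ := by fun_prop
    exact (h3.meromorphicAt.mul (this.meromorphicAt.div h2.meromorphicAt)).add hG2.meromorphicAt
  · have h1 : AnalyticAt ℂ (fun z : ℂ => 1 + t₀ * z) t₀ := by fun_prop
    have h2 : AnalyticAt ℂ (fun z : ℂ => t₀ - z) t₀ := by fun_prop
    have h3 : AnalyticAt ℂ (fun _ : ℂ => (m : ℂ)) t₀ := by fun_prop
    have hmer := (h3.meromorphicAt.mul (h1.meromorphicAt.div h2.meromorphicAt)).add
      hG2.meromorphicAt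
    refine (tendsto_cobounded_iff_meromorphicOrderAt_neg hmer).1 ?_
    rw [← tendsto_norm_atTop_iff_cobounded]
    have h4 : Tendsto (fun z : ℂ => ‖(t₀ - z)⁻¹‖) (𝓝[≠] (t₀ : ℂ)) atTop := by
      rw [tendsto_norm_atTop_iff_cobounded]
      refine (tendsto_inv₀_nhdsNE_zero (α := ℂ)).comp ?_
      refine tendsto_nhdsWithin_iff.2 ⟨?_, ?_⟩
      · have := h2.continuousAt.tendsto.mono_left (nhdsWithin_le_nhds (s := {(t₀ : ℂ)}ᶜ))
        simpa using this
      · filter_upwards [self_mem_nhdsWithin] with z hz h0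
        exact hz (sub_eq_zero.1 h0).symm
    have h5 : Tendsto (fun z : ℂ => ‖(m : ℂ) * (1 + t₀ * z)‖) (𝓝[≠] (t₀ : ℂ))
        (𝓝 ‖(m : ℂ) * (1 + t₀ * t₀)‖) :=
      ((h3.mul h1).continuousAt.tendsto.mono_left nhdsWithin_le_nhds).norm
    have h6 : 0 < ‖(m : ℂ) * (1 + t₀ * t₀)‖ := by
      rw [norm_pos_iff]
      refine mul_ne_zero (by exact_mod_cast hm0) ?_
      have : (1 : ℝ) + t₀ * t₀ ≠ 0 := by nlinarith [mul_self_nonneg t₀]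
      exact_mod_cast this
    have h7 : Tendsto (fun z : ℂ => -‖G z‖) (𝓝[≠] (t₀ : ℂ)) (𝓝 (-‖G t₀‖)) :=
      (hG2.continuousAt.tendsto.mono_left nhdsWithin_le_nhds).norm.neg
    refine tendsto_atTop_mono (fun z => ?_) ((h5.pos_mul_atTop h6 h4).atTop_add h7)
    have h8 := norm_sub_le_norm_add ((m : ℂ) * ((1 + t₀ * z) / (t₀ - z))) (G z)
    refine le_trans (le_of_eq ?_) h8
    rw [← norm_mul, mul_assoc, div_eq_mul_inv]
    exact (sub_eq_add_neg _ _).symm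

end NevanlinnaRep

theorem neBot_nhdsWithin_im_ne_zero (t : ℝ) : (𝓝[{z : ℂ | z.im ≠ 0}] (t : ℂ)).NeBot := by
  rw [← mem_closure_iff_nhdsWithin_neBot]
  have h1 : Tendsto (fun y : ℝ => (t : ℂ) + y * Complex.I) (𝓝[≠] 0) (𝓝 (t : ℂ)) := by
    have : Continuous fun y : ℝ => (t : ℂ) + y * Complex.I := by fun_prop
    have h := (this.tendsto 0).mono_left (nhdsWithin_le_nhds (s := ({0} : Set ℝ)ᶜ))
    simpa using h
  refine mem_closure_of_tendsto h1 ?_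
  filter_upwards [self_mem_nhdsWithin] with y hy
  simpa using hy

theorem HasRealPoleAt.not_isAnalyticRealAt {g : ℂ → ℂ} {t : ℝ} (h : HasRealPoleAt g t) :
    ¬ IsAnalyticRealAt g t := by
  rintro ⟨G, hG, hGa, -⟩
  obtain ⟨H, hH, hHm, hHo⟩ := h
  have hne := neBot_nhdsWithin_im_ne_zero t
  have h1 : 𝓝[{z : ℂ | z.im ≠ 0}] (t : ℂ) ≤ 𝓝[≠] (t : ℂ) := by
    apply nhdsWithin_mono
    rintro z hz rfl
    simp at hz
  have h2 := (tendsto_norm_atTop_iff_cobounded.2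
    ((tendsto_cobounded_iff_meromorphicOrderAt_neg hHm).2 hHo)).mono_left h1
  have h3 : Tendsto (fun z => ‖G z‖) (𝓝[{z : ℂ | z.im ≠ 0}] (t : ℂ)) (𝓝 ‖G t‖) :=
    (hGa.continuousAt.tendsto.mono_left nhdsWithin_le_nhds).norm
  refine not_tendsto_nhds_of_tendsto_atTop h2 ‖G t‖ (h3.congr' ?_)
  have h4 := nhdsWithin_le_nhds (s := {z : ℂ | z.im ≠ 0}) (hG.and hH)
  filter_upwards [h4, self_mem_nhdsWithin] with z hz hz0
  rw [hz.1 hz0, hz.2 hz0]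

namespace NevanlinnaRep

variable {g : ℂ → ℂ} {a b : ℝ} {ν : Measure ℝ}

/-- By symmetry the continuation is real on the axis near t₀. Being Lipschitz, it satisfies Im G(z)
= Im (G(z) - G(Re z)) ≤ K Im z, and `notMem_support_of_im_le` applies. -/
theorem notMem_support_of_isAnalyticRealAt (h : NevanlinnaRep g a b ν) {t₀ : ℝ}
    (hA : IsAnalyticRealAt g t₀) : t₀ ∉ ν.support := by
  obtain ⟨G, hG, hGa, -⟩ := hA
  obtain ⟨K, s, hs, hL⟩ := (hGa.contDiffAt (n := 1)).exists_lipschitzOnWith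
  obtain ⟨ε, hε, hball⟩ := Metric.eventually_nhds_iff.1
    ((hG.and hs).and hGa.eventually_analyticAt)
  refine h.notMem_support_of_im_le (C := K) ?_
  filter_upwards [Metric.ball_mem_nhds (t₀ : ℂ) hε] with z hz hz0
  have hx : dist ((z.re : ℝ) : ℂ) t₀ < ε := by
    refine lt_of_le_of_lt ?_ (Metric.mem_ball.1 hz)
    rw [dist_eq_norm, dist_eq_norm, ← Complex.ofReal_sub, Complex.norm_real, Real.norm_eq_abs]
    simpa using Complex.abs_re_le_norm (z - t₀)
  have hreal : (G (z.re : ℂ)).im = 0 := by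
    have hne := neBot_nhdsWithin_im_ne_zero z.re
    have hc := (hball hx).2.continuousAt
    have h1 : Tendsto G (𝓝[{z : ℂ | z.im ≠ 0}] (z.re : ℂ)) (𝓝 (G z.re)) :=
      hc.tendsto.mono_left nhdsWithin_le_nhds
    have h2 : Tendsto (fun w : ℂ => starRingEnd ℂ w) (𝓝[{z : ℂ | z.im ≠ 0}] (z.re : ℂ))
        (𝓝 (z.re : ℂ)) := by
      have := (Complex.continuous_conj.tendsto (z.re : ℂ)).mono_left
        (nhdsWithin_le_nhds (s := {z : ℂ | z.im ≠ 0}))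
      rwa [Complex.conj_ofReal] at this
    have h3 := (Complex.continuous_conj.tendsto _).comp (hc.tendsto.comp h2)
    have h4 : G z.re = starRingEnd ℂ (G z.re) := by
      refine tendsto_nhds_unique h1 (h3.congr' ?_)
      have hev : ∀ᶠ w in 𝓝[{z : ℂ | z.im ≠ 0}] (z.re : ℂ), dist w (t₀ : ℂ) < ε :=
        nhdsWithin_le_nhds (Metric.isOpen_ball.mem_nhds (Metric.mem_ball.2 hx))
      have hev2 : ∀ᶠ w in 𝓝[{z : ℂ | z.im ≠ 0}] (z.re : ℂ), dist (starRingEnd ℂ w) (t₀ : ℂ) < ε :=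
        h2.eventually (Metric.isOpen_ball.mem_nhds (Metric.mem_ball.2 hx))
      filter_upwards [hev, hev2, self_mem_nhdsWithin] with w hw hw2 hw0
      simp only [Function.comp_apply]
      rw [(hball hw).1.1 hw0, (hball hw2).1.1 (by simpa using hw0), h.symm hw0, Complex.conj_conj]
    exact Complex.conj_eq_iff_im.1 h4.symm
  have h1 := hL.norm_sub_le (hball (Metric.mem_ball.1 hz)).1.2 (hball hx).1.2
  have h2 : ‖z - z.re‖ = z.im := by
    have : z - z.re = z.im * Complex.I := by
      apply Complex.ext <;> simp
    rw [this]; simp [abs_of_pos hz0]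
  rw [h2] at h1
  rw [← (hball (Metric.mem_ball.1 hz)).1.1 hz0.ne']
  have h3 := (le_abs_self _).trans (Complex.abs_im_le_norm (G z - G z.re))
  rw [Complex.sub_im, hreal, sub_zero] at h3
  exact h3.trans h1

end NevanlinnaRep

/-! ### Lower bound for the number of negative squares -/

open scoped Matrix

/-- Diagonal dominance after rescaling to xᵢ = sᵢ|vᵢ|: the form is at most (-1/C + C/R) ∑ xᵢ² +
(2D/R)(∑ xᵢ)², and (∑ xᵢ)² ≤ n ∑ xᵢ². Hypothesis `hRC` makes the total coefficient negative. -/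
theorem re_dotProduct_mulVec_neg_of_bounds {n : ℕ} (A : Matrix (Fin n) (Fin n) ℂ) (s : Fin n → ℝ)
    {C D R : ℝ} (hD : 0 ≤ D) (hC : 0 < C) (hR : 0 < R) (hs : ∀ i, R ≤ s i)
    (hdiag : ∀ i, (A i i).re ≤ -(s i) ^ 2 / C + C * s i)
    (hoff : ∀ i j, i ≠ j → ‖A i j‖ ≤ D * (s i + s j))
    (hRC : C + 2 * D * n < R / C) {v : Fin n → ℂ} (hv : v ≠ 0) :
    (star v ⬝ᵥ A *ᵥ v).re < 0 := by
  set x : Fin n → ℝ := fun i => s i * ‖v i‖ with hx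
  have hs0 : ∀ i, 0 < s i := fun i => hR.trans_le (hs i)
  have hx0 : ∀ i, 0 ≤ x i := fun i => mul_nonneg (hs0 i).le (norm_nonneg _)
  have hterm : ∀ i j, (star v i * (A i j * v j)).re ≤
      (if i = j then (-1 / C + C / R) * x i ^ 2 else 0) + 2 * D / R * (x i * x j) := by
    intro i j
    have hxx : 0 ≤ 2 * D / R * (x i * x j) :=
      mul_nonneg (by positivity) (mul_nonneg (hx0 i) (hx0 j))
    split_ifs with hij
    · subst hij
      have e1 : (star v i * (A i i * v i)).re = (A i i).re * ‖v i‖ ^ 2 := by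
        have : star v i * (A i i * v i) = A i i * ((‖v i‖ ^ 2 : ℝ) : ℂ) := by
          rw [Pi.star_apply, RCLike.star_def, ← Complex.normSq_eq_norm_sq,
            Complex.normSq_eq_conj_mul_self]
          ring
        rw [this, Complex.re_mul_ofReal]
      rw [e1]
      have h1 : (A i i).re ≤ (-1 / C + C / R) * s i ^ 2 := by
        refine (hdiag i).trans ?_
        have : C * s i ≤ C / R * s i ^ 2 := by
          rw [div_mul_eq_mul_div, le_div_iff₀ hR]
          nlinarith [mul_nonneg (mul_pos hC (hs0 i)).le (sub_nonneg.2 (hs i))]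
        have h2 : -(s i) ^ 2 / C = -1 / C * s i ^ 2 := by ring
        rw [h2, add_mul]
        linarith
      have h2 := mul_le_mul_of_nonneg_right h1 (sq_nonneg ‖v i‖)
      have h3 : (-1 / C + C / R) * s i ^ 2 * ‖v i‖ ^ 2 = (-1 / C + C / R) * x i ^ 2 := by
        simp only [hx]; ring
      linarith
    · rw [zero_add]
      refine (Complex.re_le_norm _).trans ?_
      rw [norm_mul, norm_mul, Pi.star_apply, norm_star]
      have h1 := hoff i j hij
      -- Both sᵢ and sⱼ are at least R.
      have h2 : s i + s j ≤ 2 / R * (s i * s j) := by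
        rw [div_mul_eq_mul_div, le_div_iff₀ hR]
        nlinarith [mul_nonneg (hs0 i).le (sub_nonneg.2 (hs j)),
          mul_nonneg (hs0 j).le (sub_nonneg.2 (hs i))]
      have h3 : ‖A i j‖ ≤ D * (2 / R * (s i * s j)) :=
        h1.trans (mul_le_mul_of_nonneg_left h2 hD)
      have h4 := mul_le_mul_of_nonneg_right h3 (mul_nonneg (norm_nonneg (v i)) (norm_nonneg (v j)))
      have h5 : D * (2 / R * (s i * s j)) * (‖v i‖ * ‖v j‖) = 2 * D / R * (x i * x j) := by
        simp only [hx]; ring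
      linarith
  have hsum : (star v ⬝ᵥ A *ᵥ v).re ≤ (-1 / C + C / R) * ∑ i, x i ^ 2 +
      2 * D / R * (∑ i, x i) ^ 2 := by
    have e1 : star v ⬝ᵥ A *ᵥ v = ∑ i, ∑ j, star v i * (A i j * v j) := by
      simp only [dotProduct, Matrix.mulVec, Finset.mul_sum]
    rw [e1, Complex.re_sum]
    simp_rw [Complex.re_sum]
    refine (Finset.sum_le_sum fun i _ => Finset.sum_le_sum fun j _ => hterm i j).trans (le_of_eq ?_)
    simp only [Finset.sum_add_distrib, Finset.sum_ite_eq, Finset.mem_univ, if_true]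
    rw [sq (∑ i, x i), Finset.sum_mul_sum]
    simp only [Finset.mul_sum]
  have hcs : (∑ i, x i) ^ 2 ≤ n * ∑ i, x i ^ 2 := by
    have := sq_sum_le_card_mul_sum_sq (s := Finset.univ) (f := x)
    simpa using this
  have hpos : 0 < ∑ i, x i ^ 2 := by
    obtain ⟨i, hi⟩ := Function.ne_iff.1 hv
    refine Finset.sum_pos' (fun i _ => sq_nonneg _) ⟨i, Finset.mem_univ i, ?_⟩
    exact pow_pos (mul_pos (hs0 i) (norm_pos_iff.2 hi)) 2
  have hcoef : (-1 / C + C / R) + 2 * D / R * n < 0 := by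
    have h1 : C / R + 2 * D / R * n = (C + 2 * D * n) / R := by ring
    have h2 : (C + 2 * D * n) / R < 1 / C := by
      rw [div_lt_iff₀ hR]
      have : 1 / C * R = R / C := by ring
      rwa [this]
    have h3 : -1 / C = -(1 / C) := by ring
    linarith
  have h6 : 2 * D / R * (∑ i, x i) ^ 2 ≤ 2 * D / R * (n * ∑ i, x i ^ 2) :=
    mul_le_mul_of_nonneg_left hcs (by positivity)
  nlinarith

theorem negSquares_eq_of_neg (f : ℂ → ℂ) {n : ℕ} (z : Fin n → ℂ)
    (h : ∀ v : Fin n → ℂ, v ≠ 0 → (star v ⬝ᵥ pickMatrix f z *ᵥ v).re < 0) :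
    negSquares f z = n := by
  have hall : ∀ i, (pickMatrix_isHermitian f z).eigenvalues i < 0 := by
    intro i
    rw [Matrix.IsHermitian.eigenvalues_eq]
    refine h _ ?_
    have := (pickMatrix_isHermitian f z).eigenvectorBasis.orthonormal.ne_zero i
    intro h0
    exact this (by ext j; exact congrFun h0 j)
  rw [negSquares, Finset.filter_true_of_mem fun i _ => hall i]
  simp

theorem RatFunc.eval_ofReal (T : RatFunc ℝ) (t : ℝ) :
    T.eval (algebraMap ℝ ℂ) (t : ℂ) = ((T.eval (RingHom.id ℝ) t : ℝ) : ℂ) := by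
  have h : ∀ p : Polynomial ℝ, p.eval₂ (algebraMap ℝ ℂ) (t : ℂ) =
      ((p.eval₂ (RingHom.id ℝ) t : ℝ) : ℂ) := by
    intro p
    have := Polynomial.hom_eval₂ p (RingHom.id ℝ) (algebraMap ℝ ℂ) t
    simpa using this.symm
  rw [RatFunc.eval, RatFunc.eval, h, h, Complex.ofReal_div]

theorem RatFunc.analyticAt_eval (T : RatFunc ℝ) {z : ℂ}
    (hz : T.denom.eval₂ (algebraMap ℝ ℂ) z ≠ 0) :
    AnalyticAt ℂ (fun z => T.eval (algebraMap ℝ ℂ) z) z := by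
  have h : ∀ p : Polynomial ℝ, AnalyticAt ℂ (fun z => p.eval₂ (algebraMap ℝ ℂ) z) z := by
    intro p
    have := (AnalyticOnNhd.eval_polynomial (𝕜 := ℂ) (p.map (algebraMap ℝ ℂ))) z trivial
    simpa [Polynomial.eval_map] using this
  exact (h _).div (h _) hz

theorem analyticAt_eval_of_mem_negSet {T : RatFunc ℝ} {t : ℝ} (ht : t ∈ negSet T) :
    AnalyticAt ℂ (fun z => T.eval (algebraMap ℝ ℂ) z) (t : ℂ) := by
  apply RatFunc.analyticAt_eval
  have := Polynomial.hom_eval₂ T.denom (RingHom.id ℝ) (algebraMap ℝ ℂ) t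
  simp only [Complex.coe_algebraMap, RingHomCompTriple.comp_eq] at this
  rw [← this]
  have h := ht.1
  rw [Polynomial.eval₂_id]
  exact_mod_cast h

namespace NevanlinnaRep

variable {g : ℂ → ℂ} {a b : ℝ} {ν : Measure ℝ}

theorem frequently_im_gt (h : NevanlinnaRep g a b ν) {t : ℝ} (ht : t ∈ ν.support) (R : ℝ) :
    ∃ᶠ z : ℂ in 𝓝 (t : ℂ), 0 < z.im ∧ R * z.im < (g z).im := by
  by_contra hcon
  refine h.notMem_support_of_im_le (C := R) ?_ ht
  rw [not_frequently] at hcon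
  filter_upwards [hcon] with z hz hz0
  by_contra h1
  exact hz ⟨hz0, not_le.1 h1⟩

/-- Im (Tg)/Im z = Re T · (Im g / Im z) + Im T · Re g / Im z. Near t, Re T is below a negative
constant; Im T = O(Im z) because T is real on the axis, so the second term is O(|g|), which
`norm_le` controls. Stating it for all large C gives one constant for finitely many points. -/
theorem eventually_ratMul_bounds (h : NevanlinnaRep g a b ν)
    (hg : DifferentiableOn ℂ g {z : ℂ | z.im ≠ 0}) {T : RatFunc ℝ} {t : ℝ}
    (ht : t ∈ negSet T) :
    ∀ᶠ C : ℝ in atTop, ∀ᶠ z : ℂ in 𝓝 (t : ℂ), 0 < z.im → AnalyticAt ℂ (ratMul T g) z ∧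
      ‖ratMul T g z‖ ≤ C * √((g z).im / z.im + 1) ∧
      (ratMul T g z).im / z.im ≤
        -(√((g z).im / z.im + 1)) ^ 2 / C + C * √((g z).im / z.im + 1) := by
  set τ : ℂ → ℂ := fun z => T.eval (algebraMap ℝ ℂ) z with hτ
  have hτa : AnalyticAt ℂ τ (t : ℂ) := analyticAt_eval_of_mem_negSet ht
  -- Half of |T(t)|, so that Re T, equal to -2c at t, stays below -c nearby.
  set c : ℝ := -T.eval (RingHom.id ℝ) t / 2 with hc
  have hc0 : 0 < c := by have := ht.2; simp only [hc]; linarith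
  have hτt : (τ t).re = -(2 * c) := by
    simp only [hτ, RatFunc.eval_ofReal, Complex.ofReal_re, hc]; ring
  obtain ⟨K, s, hs, hL⟩ := (hτa.contDiffAt (n := 1)).exists_lipschitzOnWith
  have e1 : ∀ᶠ z in 𝓝 (t : ℂ), (τ z).re < -c := by
    have hcont : ContinuousAt (fun z => (τ z).re) (t : ℂ) :=
      Complex.continuous_re.continuousAt.comp hτa.continuousAt
    exact hcont.eventually_lt_const (by beta_reduce; rw [hτt]; linarith)
  have e2 : ∀ᶠ z in 𝓝 (t : ℂ), ‖τ z‖ < ‖τ t‖ + 1 :=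
    hτa.continuousAt.norm.eventually_lt_const (by linarith)
  have e3 : ∀ᶠ z in 𝓝 (t : ℂ), ((z.re : ℝ) : ℂ) ∈ s := by
    have hcont : ContinuousAt (fun z : ℂ => ((z.re : ℝ) : ℂ)) (t : ℂ) :=
      (Complex.continuous_ofReal.comp Complex.continuous_re).continuousAt
    exact hcont.eventually_mem (by simpa using hs)
  set N : ℝ := |a| + b * (|t| + 1) + (ν.real Set.univ + 1 + (|t| + 1) ^ 2) / 2 with hN
  have hN0 : 0 ≤ N := by
    have := h.nonneg
    have : 0 ≤ ν.real Set.univ := measureReal_nonneg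
    positivity
  have e4 : ∀ᶠ z in 𝓝 (t : ℂ), ‖z‖ < |t| + 1 := by
    have : ContinuousAt (fun z : ℂ => ‖z‖) (t : ℂ) := continuous_norm.continuousAt
    exact this.eventually_lt_const (by simp)
  filter_upwards [eventually_ge_atTop ((‖τ t‖ + 1) * N), eventually_ge_atTop (K * N + c),
    eventually_ge_atTop (1 / c), eventually_gt_atTop 0] with C hC1 hC2 hC3 hC0
  filter_upwards [e1, e2, e3, e4, hs, hτa.eventually_analyticAt] with z h1 h2 h3 h4 h5 h6 hz
  have hz0 : z.im ≠ 0 := hz.ne'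
  set k := (g z).im / z.im with hk
  have hk0 : 0 ≤ k := h.im_div_nonneg hz0
  set r := √(k + 1) with hr
  have hr2 : r ^ 2 = k + 1 := Real.sq_sqrt (by linarith)
  have hr1 : 1 ≤ r := by
    rw [hr]; exact Real.one_le_sqrt.2 (by linarith)
  have hgb : ‖g z‖ ≤ N * r := by
    have h7 := h.norm_le hz0
    rw [← hk, ← hr, Complex.normSq_eq_norm_sq] at h7
    have h8 : ‖z‖ ^ 2 ≤ (|t| + 1) ^ 2 := pow_le_pow_left₀ (norm_nonneg _) h4.le 2
    have h9 : b * ‖z‖ ≤ b * (|t| + 1) := mul_le_mul_of_nonneg_left h4.le h.nonneg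
    have h10 : |a| + b * ‖z‖ ≤ (|a| + b * (|t| + 1)) * r := by
      have : 0 ≤ |a| + b * (|t| + 1) := by
        have := h.nonneg
        positivity
      nlinarith
    have h11 : (ν.real Set.univ + 1 + ‖z‖ ^ 2) / 2 * r ≤
        (ν.real Set.univ + 1 + (|t| + 1) ^ 2) / 2 * r :=
      mul_le_mul_of_nonneg_right (by linarith) (by linarith)
    rw [hN, add_mul]
    linarith
  have hopen : IsOpen {z : ℂ | z.im ≠ 0} := isOpen_ne_fun Complex.continuous_im continuous_const
  have hga : AnalyticAt ℂ g z := hg.analyticAt (hopen.mem_nhds hz0)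
  refine ⟨h6.mul hga, ?_, ?_⟩
  · change ‖τ z * g z‖ ≤ _
    rw [norm_mul]
    calc ‖τ z‖ * ‖g z‖ ≤ (‖τ t‖ + 1) * (N * r) :=
          mul_le_mul h2.le hgb (norm_nonneg _) (by positivity)
      _ = ((‖τ t‖ + 1) * N) * r := by ring
      _ ≤ C * r := mul_le_mul_of_nonneg_right hC1 (by linarith)
  · have hIm : |(τ z).im| ≤ K * z.im := by
      have h7 := hL.norm_sub_le h5 h3
      have h8 : ‖z - z.re‖ = z.im := by
        have : z - z.re = z.im * Complex.I := by
          apply Complex.ext <;> simp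
        rw [this]; simp [abs_of_pos hz]
      rw [h8] at h7
      have h9 := (Complex.abs_im_le_norm (τ z - τ z.re)).trans h7
      have h10 : (τ z.re).im = 0 := by simp only [hτ, RatFunc.eval_ofReal, Complex.ofReal_im]
      rwa [Complex.sub_im, h10, sub_zero] at h9
    change (τ z * g z).im / z.im ≤ _
    have h7 : (τ z * g z).im / z.im = (τ z).re * k + (τ z).im * (g z).re / z.im := by
      rw [Complex.mul_im, hk]; field_simp
    have h8 : (τ z).im * (g z).re / z.im ≤ K * (N * r) := by
      rw [div_le_iff₀ hz]
      calc (τ z).im * (g z).re ≤ |(τ z).im| * |(g z).re| := by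
            rw [← abs_mul]; exact le_abs_self _
        _ ≤ (K * z.im) * (N * r) := mul_le_mul hIm ((Complex.abs_re_le_norm _).trans hgb)
            (abs_nonneg _) (by positivity)
        _ = _ := by ring
    -- Here k = r² - 1, and the leftover c is at most c r since r ≥ 1.
    have h9 : (τ z).re * k ≤ -c * r ^ 2 + c * r := by
      rw [hr2]
      nlinarith
    have h10 : -c * r ^ 2 ≤ -r ^ 2 / C := by
      have : 1 / C ≤ c := by
        rw [div_le_iff₀ hC0]
        rwa [div_le_iff₀ hc0, mul_comm] at hC3
      have h11 : -r ^ 2 / C = -(1 / C * r ^ 2) := by ring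
      rw [h11]
      nlinarith [sq_nonneg r]
    have h12 : (K * N + c) * r ≤ C * r := mul_le_mul_of_nonneg_right hC2 (by linarith)
    rw [h7]
    nlinarith

theorem encard_negSet_inter_support_le (h : NevanlinnaRep g a b ν)
    (hg : DifferentiableOn ℂ g {z : ℂ | z.im ≠ 0}) {T : RatFunc ℝ} {κ : ℕ}
    (hf : IsGenNevanlinna κ (ratMul T g)) : (negSet T ∩ ν.support).encard ≤ κ := by
  by_contra hcon
  have hcon : ((κ + 1 : ℕ) : ℕ∞) ≤ (negSet T ∩ ν.support).encard := by
    push_cast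
    exact Order.add_one_le_of_lt (not_le.1 hcon)
  obtain ⟨X, hX, hXc⟩ := Set.exists_subset_encard_eq hcon
  have hXf : X.Finite := Set.finite_of_encard_eq_coe hXc
  have hcard : Nat.card X = κ + 1 := by
    have : X.ncard = κ + 1 := by rw [Set.ncard, hXc]; simp
    exact this
  have : Finite X := hXf
  set e := (Finite.equivFinOfCardEq hcard).symm
  set t : Fin (κ + 1) → ℝ := fun i => e i with ht
  have htinj : Function.Injective t := Subtype.val_injective.comp e.injective
  have htX : ∀ i, t i ∈ negSet T ∩ ν.support := fun i => hX (e i).2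
  obtain ⟨C, hC, hC0⟩ := ((eventually_all.2 fun i =>
    h.eventually_ratMul_bounds hg (htX i).1).and (eventually_gt_atTop (0 : ℝ))).exists
  -- Nodes within d of points 3d apart have real parts at least d apart, which bounds the
  -- off-diagonal denominators below; conjugation leaves real parts unchanged.
  obtain ⟨d, hd, hd0⟩ : ∃ d : ℝ, (∀ i j, i ≠ j → 3 * d ≤ |t i - t j|) ∧ 0 < d := by
    have : ∀ᶠ d : ℝ in 𝓝[>] 0, ∀ i j, i ≠ j → 3 * d ≤ |t i - t j| := by
      rw [eventually_all]; intro i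
      rw [eventually_all]; intro j
      by_cases hij : i = j
      · exact Eventually.of_forall fun _ h => absurd hij h
      have hpos : 0 < |t i - t j| := abs_pos.2 (sub_ne_zero.2 (htinj.ne hij))
      have : ∀ᶠ d : ℝ in 𝓝 0, d < |t i - t j| / 3 := eventually_lt_nhds (by positivity)
      filter_upwards [nhdsWithin_le_nhds this] with d hd _
      linarith
    exact (this.and self_mem_nhdsWithin).exists
  set D := C / d with hD
  have hD0 : 0 < D := by positivity
  -- Chosen so that R/C exceeds C + 2D(κ + 1), as the dominance lemma requires.
  set R : ℝ := C * (C + 2 * D * (κ + 1 : ℕ)) + 1 with hR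
  have hR0 : 0 < R := by positivity
  have hz : ∀ i, ∃ z : ℂ, 0 < z.im ∧ ‖z - t i‖ < d ∧ R ≤ √((g z).im / z.im + 1) ∧
      AnalyticAt ℂ (ratMul T g) z ∧
      ‖ratMul T g z‖ ≤ C * √((g z).im / z.im + 1) ∧
      (ratMul T g z).im / z.im ≤
        -(√((g z).im / z.im + 1)) ^ 2 / C + C * √((g z).im / z.im + 1) := by
    intro i
    have hball : ∀ᶠ z : ℂ in 𝓝 (t i : ℂ), ‖z - t i‖ < d := by
      filter_upwards [Metric.ball_mem_nhds (t i : ℂ) hd0] with z hz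
      rwa [← dist_eq_norm]
    obtain ⟨z, ⟨hz1, hz2⟩, hz3, hz4⟩ := ((h.frequently_im_gt (htX i).2 (R ^ 2)).and_eventually
      ((hC i).and hball)).exists
    refine ⟨z, hz1, hz4, ?_, hz3 hz1⟩
    apply Real.le_sqrt_of_sq_le
    have := (lt_div_iff₀ hz1).2 hz2
    linarith
  choose z hz1 hz2 hz3 hz4 hz5 hz6 using hz
  have hneg : ∀ v : Fin (κ + 1) → ℂ, v ≠ 0 →
      (star v ⬝ᵥ pickMatrix (ratMul T g) z *ᵥ v).re < 0 := by
    intro v hv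
    refine re_dotProduct_mulVec_neg_of_bounds _ (fun i => √((g (z i)).im / (z i).im + 1))
      hD0.le hC0 hR0 hz3 ?_ ?_ ?_ hv
    · intro i
      refine le_trans (le_of_eq ?_) (hz6 i)
      simp only [pickMatrix, Matrix.of_apply, Complex.sub_conj]
      rw [mul_div_mul_right _ _ Complex.I_ne_zero, ← Complex.ofReal_div, Complex.ofReal_re]
      exact mul_div_mul_left _ _ two_ne_zero
    · intro i j hij
      simp only [pickMatrix, Matrix.of_apply]
      have hdist : d ≤ ‖z i - starRingEnd ℂ (z j)‖ := by
        have h1 := Complex.abs_re_le_norm (z i - starRingEnd ℂ (z j))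
        have h2 := (Complex.abs_re_le_norm (z i - t i)).trans_lt (hz2 i)
        have h3 := (Complex.abs_re_le_norm (z j - t j)).trans_lt (hz2 j)
        simp only [Complex.sub_re, Complex.conj_re, Complex.ofReal_re] at h1 h2 h3
        have h4 := hd i j hij
        rw [abs_lt] at h2 h3
        refine le_trans ?_ h1
        rcases le_abs.1 h4 with h5 | h5
        · exact le_abs.2 (Or.inl (by linarith [h2.1, h3.2]))
        · exact le_abs.2 (Or.inr (by linarith [h2.2, h3.1]))
      rw [norm_div, hD, div_mul_eq_mul_div]
      refine div_le_div₀ ?_ ?_ hd0 hdist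
      · exact mul_nonneg hC0.le (add_nonneg (Real.sqrt_nonneg _) (Real.sqrt_nonneg _))
      · refine (norm_sub_le _ _).trans ?_
        rw [RCLike.norm_conj, mul_add]
        exact add_le_add (hz5 i) (hz5 j)
    · rw [lt_div_iff₀ hC0, hR]
      linarith
  have h1 := hf.negSquares_le (κ + 1) (Nat.succ_pos _) z fun i => ⟨hz1 i, hz4 i⟩
  rw [negSquares_eq_of_neg _ _ hneg] at h1
  omega

end NevanlinnaRep

theorem IsAnalyticRealAt.not_hasRealPoleAt_ratMul {g : ℂ → ℂ} {T : RatFunc ℝ} {t : ℝ}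
    (ht : t ∈ negSet T) (h : IsAnalyticRealAt g t) : ¬ HasRealPoleAt (ratMul T g) t := by
  intro hp
  refine hp.not_isAnalyticRealAt ?_
  obtain ⟨G, hG, hGa, hG0⟩ := h
  refine ⟨fun z => T.eval (algebraMap ℝ ℂ) z * G z, ?_,
    (analyticAt_eval_of_mem_negSet ht).mul hGa, ?_⟩
  · filter_upwards [hG] with z hz hz0
    rw [hz hz0, ratMul]
  · beta_reduce
    rw [RatFunc.eval_ofReal, Complex.im_ofReal_mul, hG0, mul_zero]

/-! ### Upper bound for the number of negative squares -/

open Polynomial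

/-- With more than N negative eigenvalues, L would have a nonzero kernel vector in the span of their
eigenvectors, where the form is negative. -/
theorem card_neg_eigenvalues_le {n N : ℕ} {A : Matrix (Fin n) (Fin n) ℂ} (hA : A.IsHermitian)
    (L : (Fin n → ℂ) →ₗ[ℂ] (Fin N → ℂ)) (hL : ∀ v, L v = 0 → 0 ≤ (star v ⬝ᵥ A *ᵥ v).re) :
    (Finset.univ.filter fun i => hA.eigenvalues i < 0).card ≤ N := by
  by_contra hcon
  rw [not_le] at hcon
  set I := {i : Fin n // hA.eigenvalues i < 0}
  set E : (I → ℂ) →ₗ[ℂ] (Fin n → ℂ) :=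
    (Matrix.mulVecLin (hA.eigenvectorUnitary : Matrix (Fin n) (Fin n) ℂ)) ∘ₗ
      (Function.ExtendByZero.linearMap ℂ (Subtype.val : I → Fin n)) with hE
  have hcard : Fintype.card I = (Finset.univ.filter fun i => hA.eigenvalues i < 0).card :=
    Fintype.card_subtype _
  have hninj : ¬ Function.Injective (L ∘ₗ E) := by
    intro hinj
    have := LinearMap.finrank_le_finrank_of_injective hinj
    simp only [Module.finrank_fintype_fun_eq_card, Fintype.card_fin] at this
    omega
  rw [← LinearMap.ker_eq_bot, Submodule.eq_bot_iff] at hninj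
  push Not at hninj
  obtain ⟨c, hc, hc0⟩ := hninj
  have h1 := hL (E c) hc
  set c' : Fin n → ℂ := Function.extend Subtype.val c 0 with hc'
  have hEc : E c = (hA.eigenvectorUnitary : Matrix (Fin n) (Fin n) ℂ) *ᵥ c' := rfl
  have h2 : (star (E c) ⬝ᵥ A *ᵥ (E c)) = ∑ i, ((hA.eigenvalues i * ‖c' i‖ ^ 2 : ℝ) : ℂ) := by
    have h3 := hA.conjStarAlgAut_star_eigenvectorUnitary
    rw [Unitary.conjStarAlgAut_star_apply] at h3
    rw [hEc, Matrix.star_mulVec, Matrix.dotProduct_mulVec, Matrix.vecMul_vecMul,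
      ← Matrix.dotProduct_mulVec, Matrix.mulVec_mulVec, ← Matrix.star_eq_conjTranspose, h3]
    refine Finset.sum_congr rfl fun i _ => ?_
    rw [Matrix.mulVec_diagonal, Pi.star_apply, RCLike.star_def, ← Complex.normSq_eq_norm_sq]
    push_cast
    rw [Complex.normSq_eq_conj_mul_self]
    simp only [Function.comp_apply, Complex.coe_algebraMap]
    ring
  rw [h2, ← Complex.ofReal_sum, Complex.ofReal_re] at h1
  have hoff : ∀ i, ¬ hA.eigenvalues i < 0 → c' i = 0 := by
    intro i hi
    rw [hc', Function.extend_apply']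
    · rfl
    · rintro ⟨⟨j, hj⟩, rfl⟩
      exact hi hj
  obtain ⟨i, hi⟩ := Function.ne_iff.1 hc0
  refine absurd h1 (not_le.2 (Finset.sum_neg' (fun j _ => ?_) ⟨i.1, Finset.mem_univ _, ?_⟩))
  · by_cases hj : hA.eigenvalues j < 0
    · exact mul_nonpos_of_nonpos_of_nonneg hj.le (sq_nonneg _)
    · rw [hoff j hj]; simp
  · refine mul_neg_of_neg_of_pos i.2 (pow_pos (norm_pos_iff.2 ?_) 2)
    rw [hc', Subtype.val_injective.extend_apply]
    exact hi

theorem sum_mul_eval_eq_zero {n N : ℕ} {ξ w : Fin n → ℂ} (hξ : ∀ a < N, ∑ j, ξ j * w j ^ a = 0)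
    {Q : ℂ[X]} (hQ : Q.natDegree < N) : ∑ j, ξ j * Q.eval (w j) = 0 := by
  simp_rw [eval_eq_sum_range' hQ, Finset.mul_sum]
  rw [Finset.sum_comm]
  refine Finset.sum_eq_zero fun a ha => ?_
  have := hξ a (Finset.mem_range.1 ha)
  calc ∑ j, ξ j * (Q.coeff a * w j ^ a) = Q.coeff a * ∑ j, ξ j * w j ^ a := by
        rw [Finset.mul_sum]
        exact Finset.sum_congr rfl fun j _ => by ring
    _ = 0 := by rw [this, mul_zero]

/-- The divided difference of R at x is a polynomial in w of degree below deg R, so the moment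
conditions annihilate it. -/
theorem sum_mul_divDifference_eq_zero {n N : ℕ} {ξ w : Fin n → ℂ}
    (hξ : ∀ a < N, ∑ j, ξ j * w j ^ a = 0) {R : ℂ[X]} (hR : R.natDegree ≤ N) {x : ℂ}
    (hx : ∀ j, x - w j ≠ 0) : ∑ j, ξ j * ((R.eval x - R.eval (w j)) / (x - w j)) = 0 := by
  obtain ⟨Q, hQ⟩ := X_sub_C_dvd_sub_C_eval (a := x) (p := R)
  have hev : ∀ j, (R.eval x - R.eval (w j)) / (x - w j) = Q.eval (w j) := by
    intro j
    have := congrArg (Polynomial.eval (w j)) hQ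
    simp only [eval_sub, eval_mul, eval_X, eval_C] at this
    rw [div_eq_iff (hx j)]
    linear_combination -this
  simp_rw [hev]
  by_cases hQ0 : Q = 0
  · simp [hQ0]
  refine sum_mul_eval_eq_zero hξ ?_
  have h1 := congrArg natDegree hQ
  rw [natDegree_sub_C, natDegree_mul (X_sub_C_ne_zero x) hQ0, natDegree_X_sub_C] at h1
  omega

/-- The sesquilinear Pick form of `(A / M) h`, after clearing the denominator `M`. -/
noncomputable def clearedForm {n : ℕ} (ξ η z w : Fin n → ℂ) (M A : ℂ[X]) (h : ℂ → ℂ) : ℂ :=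
  ∑ k, ∑ j, ξ k * η j * ((M.eval (w j) * A.eval (z k) * h (z k) -
    M.eval (z k) * A.eval (w j) * h (w j)) / (z k - w j))

/-- Exchanging M(w) for M(z), or conversely, costs a divided difference of M, which the moments
kill. Thus only the product MA matters, and the sign condition can be imposed on it. -/
theorem clearedForm_eq {n N : ℕ} {ξ η z w : Fin n → ℂ} (hξ : ∀ a < N, ∑ j, ξ j * z j ^ a = 0)
    (hη : ∀ a < N, ∑ j, η j * w j ^ a = 0) (hzw : ∀ k j, z k - w j ≠ 0) {M : ℂ[X]} (A : ℂ[X])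
    (hM : M.natDegree ≤ N) (h : ℂ → ℂ) :
    clearedForm ξ η z w M A h = ∑ k, ∑ j, ξ k * η j *
      (((M * A).eval (z k) * h (z k) - (M * A).eval (w j) * h (w j)) / (z k - w j)) := by
  have h1 : ∑ k, ∑ j, ξ k * η j * ((M.eval (z k) - M.eval (w j)) / (z k - w j)) *
      (A.eval (z k) * h (z k)) = 0 := by
    refine Finset.sum_eq_zero fun k _ => ?_
    have := sum_mul_divDifference_eq_zero hη hM (hzw k)
    calc _ = ξ k * (A.eval (z k) * h (z k)) *
          ∑ j, η j * ((M.eval (z k) - M.eval (w j)) / (z k - w j)) := by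
          rw [Finset.mul_sum]
          exact Finset.sum_congr rfl fun j _ => by ring
      _ = 0 := by rw [this, mul_zero]
  have h2 : ∑ k, ∑ j, ξ k * η j * ((M.eval (z k) - M.eval (w j)) / (z k - w j)) *
      (A.eval (w j) * h (w j)) = 0 := by
    rw [Finset.sum_comm]
    refine Finset.sum_eq_zero fun j _ => ?_
    have := sum_mul_divDifference_eq_zero hξ hM (x := w j)
      fun k => by rw [← neg_sub]; exact neg_ne_zero.2 (hzw k j)
    calc _ = η j * (A.eval (w j) * h (w j)) *
          ∑ k, ξ k * ((M.eval (w j) - M.eval (z k)) / (w j - z k)) := by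
          rw [Finset.mul_sum]
          refine Finset.sum_congr rfl fun k _ => ?_
          rw [← neg_sub (M.eval (z k)), ← neg_sub (z k), neg_div_neg_eq]
          ring
      _ = 0 := by rw [this, mul_zero]
  rw [clearedForm, ← sub_zero (∑ k, ∑ j, ξ k * η j * (((M * A).eval (z k) * h (z k) -
    (M * A).eval (w j) * h (w j)) / (z k - w j))), ← h1, ← sub_zero (_ - _), ← h2,
    ← Finset.sum_sub_distrib, ← Finset.sum_sub_distrib]
  refine Finset.sum_congr rfl fun k _ => ?_
  rw [← Finset.sum_sub_distrib, ← Finset.sum_sub_distrib]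
  refine Finset.sum_congr rfl fun j _ => ?_
  simp only [eval_mul]
  ring

theorem clearedForm_polynomial {n N : ℕ} {ξ η z w : Fin n → ℂ}
    (hξ : ∀ a < N, ∑ j, ξ j * z j ^ a = 0)
    (hη : ∀ a < N, ∑ j, η j * w j ^ a = 0) (hzw : ∀ k j, z k - w j ≠ 0) {M A h : ℂ[X]}
    (hM : M.natDegree ≤ N) (hN : (M * A * h).natDegree ≤ N) :
    clearedForm ξ η z w M A (fun x => h.eval x) = 0 := by
  rw [clearedForm_eq hξ hη hzw A hM]
  refine Finset.sum_eq_zero fun k _ => ?_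
  have := sum_mul_divDifference_eq_zero hη hN (hzw k)
  simp only [eval_mul] at this ⊢
  simp_rw [mul_assoc (ξ k)]
  rw [← Finset.mul_sum, this, mul_zero]

/-- Writing P(x) = P(t) + (x - t)Q(x), the Q part is killed by the moments. The divided difference
of 1/(t - x) factors as 1/((t - z)(t - w)), leaving a rank-one form. -/
theorem clearedForm_cauchy {n N : ℕ} {ξ η z w : Fin n → ℂ}
    (hξ : ∀ a < N, ∑ j, ξ j * z j ^ a = 0)
    (hη : ∀ a < N, ∑ j, η j * w j ^ a = 0) (hzw : ∀ k j, z k - w j ≠ 0) {M A : ℂ[X]}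
    (hM : M.natDegree ≤ N) (hN : (M * A).natDegree ≤ N) {t : ℂ} (htz : ∀ k, t - z k ≠ 0)
    (htw : ∀ j, t - w j ≠ 0) :
    clearedForm ξ η z w M A (fun x => (t - x)⁻¹) =
      (M * A).eval t * ((∑ k, ξ k * (t - z k)⁻¹) * ∑ j, η j * (t - w j)⁻¹) := by
  rw [clearedForm_eq hξ hη hzw A hM]
  set P := M * A
  obtain ⟨Q, hQ⟩ := X_sub_C_dvd_sub_C_eval (a := t) (p := P)
  have hev : ∀ x, P.eval x = P.eval t + (x - t) * Q.eval x := by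
    intro x
    have := congrArg (Polynomial.eval x) hQ
    simp only [eval_sub, eval_mul, eval_X, eval_C] at this
    linear_combination this
  have hQN : Q.natDegree ≤ N := by
    by_cases hQ0 : Q = 0
    · simp [hQ0]
    have h1 := congrArg natDegree hQ
    rw [natDegree_sub_C, natDegree_mul (X_sub_C_ne_zero t) hQ0, natDegree_X_sub_C] at h1
    omega
  have h0 : ∑ k, ∑ j, ξ k * η j * ((Q.eval (z k) - Q.eval (w j)) / (z k - w j)) = 0 := by
    refine Finset.sum_eq_zero fun k _ => ?_
    simp_rw [mul_assoc (ξ k)]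
    rw [← Finset.mul_sum, sum_mul_divDifference_eq_zero hη hQN (hzw k), mul_zero]
  rw [Finset.sum_mul_sum, Finset.mul_sum, ← sub_zero (∑ k, _ * _), ← h0, ← Finset.sum_sub_distrib]
  refine Finset.sum_congr rfl fun k _ => ?_
  rw [Finset.mul_sum, ← Finset.sum_sub_distrib]
  refine Finset.sum_congr rfl fun j _ => ?_
  have h1 := hzw k j
  have h2 := htz k
  have h3 := htw j
  rw [hev (z k), hev (w j)]
  field_simp
  ring

theorem clearedForm_congr {n : ℕ} {ξ η z w : Fin n → ℂ} {M A : ℂ[X]} {h h' : ℂ → ℂ}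
    (hz : ∀ k, h (z k) = h' (z k)) (hw : ∀ j, h (w j) = h' (w j)) :
    clearedForm ξ η z w M A h = clearedForm ξ η z w M A h' := by
  simp only [clearedForm, hz, hw]

theorem clearedForm_add_smul {n : ℕ} (ξ η z w : Fin n → ℂ) (M A : ℂ[X]) (h h' : ℂ → ℂ) (c : ℂ) :
    clearedForm ξ η z w M A (fun x => h x + c * h' x) =
      clearedForm ξ η z w M A h + c * clearedForm ξ η z w M A h' := by
  simp only [clearedForm, Finset.mul_sum, ← Finset.sum_add_distrib]
  refine Finset.sum_congr rfl fun k _ => Finset.sum_congr rfl fun j _ => ?_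
  ring

theorem clearedForm_integral {n : ℕ} (ξ η z w : Fin n → ℂ) (M A : ℂ[X]) {ν : Measure ℝ}
    {h : ℝ → ℂ → ℂ} (hz : ∀ k, Integrable (fun t => h t (z k)) ν)
    (hw : ∀ j, Integrable (fun t => h t (w j)) ν) :
    clearedForm ξ η z w M A (fun x => ∫ t, h t x ∂ν) =
      ∫ t, clearedForm ξ η z w M A (h t) ∂ν := by
  have hint : ∀ k j, Integrable (fun t => ξ k * η j * ((M.eval (w j) * A.eval (z k) * h t (z k) -
      M.eval (z k) * A.eval (w j) * h t (w j)) / (z k - w j))) ν := fun k j =>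
    ((((hz k).const_mul _).sub ((hw j).const_mul _)).div_const _).const_mul _
  simp only [clearedForm]
  rw [integral_finsetSum _ fun k _ => integrable_finsetSum _ fun j _ => hint k j]
  refine Finset.sum_congr rfl fun k _ => ?_
  rw [integral_finsetSum _ fun j _ => hint k j]
  refine Finset.sum_congr rfl fun j _ => ?_
  rw [integral_const_mul, integral_div, integral_sub ((hz k).const_mul _) ((hw j).const_mul _),
    integral_const_mul, integral_const_mul]

theorem eval_map_conj (p : ℝ[X]) (z : ℂ) :
    (p.map (algebraMap ℝ ℂ)).eval (starRingEnd ℂ z) =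
      starRingEnd ℂ ((p.map (algebraMap ℝ ℂ)).eval z) := by
  rw [eval_map, eval_map, hom_eval₂]
  congr 1
  ext x
  simp

theorem eval_map_ofReal (p : ℝ[X]) (t : ℝ) :
    (p.map (algebraMap ℝ ℂ)).eval (t : ℂ) = ((p.eval t : ℝ) : ℂ) := by
  rw [eval_map]
  exact eval₂_at_apply (algebraMap ℝ ℂ) t

namespace NevanlinnaRep

variable {g : ℂ → ℂ} {a b : ℝ} {ν : Measure ℝ}

/-- Up to polynomials, g is a superposition of Cauchy kernels; with w = z̄ and η = ξ̄ each rank-one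
form is a squared modulus. The extra 1 in `hN` makes room for the linear term a + bx. -/
theorem clearedForm_eq_integral (hrep : NevanlinnaRep g a b ν) {n N : ℕ} {ξ z : Fin n → ℂ}
    (hz : ∀ k, 0 < (z k).im) (hξ : ∀ i < N, ∑ j, ξ j * z j ^ i = 0) {M A : ℝ[X]}
    (hN : M.natDegree + A.natDegree + 1 ≤ N) :
    clearedForm ξ (fun j => starRingEnd ℂ (ξ j)) z (fun j => starRingEnd ℂ (z j))
      (M.map (algebraMap ℝ ℂ)) (A.map (algebraMap ℝ ℂ)) g =
    ((∫ t : ℝ, (1 + t ^ 2) * ((M * A).eval t * Complex.normSq (∑ k, ξ k * ((t : ℂ) - z k)⁻¹)) ∂ν :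
      ℝ) : ℂ) := by
  have := hrep.finite
  set w : Fin n → ℂ := fun j => starRingEnd ℂ (z j) with hw
  set η : Fin n → ℂ := fun j => starRingEnd ℂ (ξ j) with hη'
  set Mc := M.map (algebraMap ℝ ℂ) with hMc
  set Ac := A.map (algebraMap ℝ ℂ) with hAc
  have hz0 : ∀ k, (z k).im ≠ 0 := fun k => (hz k).ne'
  have hw0 : ∀ j, (w j).im ≠ 0 := fun j => by simpa [hw] using hz0 j
  have hη : ∀ i < N, ∑ j, η j * w j ^ i = 0 := by
    intro i hi
    have := congrArg (starRingEnd ℂ) (hξ i hi)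
    simpa [hη', hw] using this
  have hzw : ∀ k j, z k - w j ≠ 0 := by
    intro k j h
    have := congrArg Complex.im h
    simp [hw] at this
    linarith [hz k, hz j]
  have hMd : Mc.natDegree ≤ M.natDegree := natDegree_map_le
  have hAd : Ac.natDegree ≤ A.natDegree := natDegree_map_le
  have hMN : Mc.natDegree ≤ N := by omega
  have hPN : (Mc * Ac).natDegree ≤ M.natDegree + A.natDegree :=
    natDegree_mul_le.trans (by omega)
  have hker : ∀ t : ℝ, clearedForm ξ η z w Mc Ac (fun x => (1 + t * x) / ((t : ℂ) - x)) =
      (((1 + t ^ 2) * ((M * A).eval t * Complex.normSq (∑ k, ξ k * ((t : ℂ) - z k)⁻¹)) : ℝ) :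
        ℂ) := by
    intro t
    -- In contrast to `nevanlinnaKernel_eq`, the polynomial part is constant in x.
    have hid : ∀ x : ℂ, x.im ≠ 0 → (1 + t * x) / ((t : ℂ) - x) =
        (C (-(t : ℂ))).eval x + (1 + (t : ℂ) ^ 2) * ((t : ℂ) - x)⁻¹ := by
      intro x hx
      have := ofReal_sub_ne_zero hx t
      rw [eval_C]
      field_simp
      ring
    rw [clearedForm_congr (h' := fun x => (C (-(t : ℂ))).eval x +
        (1 + (t : ℂ) ^ 2) * ((t : ℂ) - x)⁻¹) (fun k => hid _ (hz0 k)) (fun j => hid _ (hw0 j)),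
      clearedForm_add_smul ξ η z w Mc Ac (fun x => (C (-(t : ℂ))).eval x) (fun x => ((t : ℂ) - x)⁻¹),
      clearedForm_polynomial hξ hη hzw hMN (natDegree_mul_le.trans (by rw [natDegree_C]; omega)),
      clearedForm_cauchy hξ hη hzw hMN (by omega) (fun k => ofReal_sub_ne_zero (hz0 k) t)
        (fun j => ofReal_sub_ne_zero (hw0 j) t)]
    have hconj : ∑ j, η j * ((t : ℂ) - w j)⁻¹ =
        starRingEnd ℂ (∑ k, ξ k * ((t : ℂ) - z k)⁻¹) := by
      simp [hη', hw]
    rw [hconj, Complex.mul_conj, hMc, hAc, ← Polynomial.map_mul, eval_map_ofReal]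
    push_cast
    ring
  set l : ℂ[X] := C (a : ℂ) + C (b : ℂ) * X with hl
  have hg : ∀ x : ℂ, x.im ≠ 0 → g x = l.eval x +
      1 * ∫ t : ℝ, (1 + t * x) / ((t : ℂ) - x) ∂ν := by
    intro x hx
    rw [hrep.eq x hx]
    simp [hl]
  have hlin : l.natDegree ≤ 1 := by
    refine (natDegree_add_le _ _).trans (max_le (by simp) ?_)
    exact (natDegree_C_mul_le _ _).trans natDegree_X_le
  rw [clearedForm_congr (h' := fun x => l.eval x +
      1 * ∫ t : ℝ, (1 + t * x) / ((t : ℂ) - x) ∂ν) (fun k => hg _ (hz0 k))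
      (fun j => hg _ (hw0 j)),
    clearedForm_add_smul ξ η z w Mc Ac (fun x => l.eval x)
      (fun x => ∫ t : ℝ, (1 + t * x) / ((t : ℂ) - x) ∂ν),
    clearedForm_polynomial hξ hη hzw hMN (natDegree_mul_le.trans (by omega)),
    clearedForm_integral (h := fun t x => (1 + t * x) / ((t : ℂ) - x))
      _ _ _ _ _ _ (fun k => integrable_nevanlinnaKernel (hz0 k) ν)
      (fun j => integrable_nevanlinnaKernel (hw0 j) ν)]
  simp_rw [hker]
  rw [integral_complex_ofReal]
  ring

theorem negSquares_le_of_eval_ne_zero (hrep : NevanlinnaRep g a b ν) {f : ℂ → ℂ} {M A : ℝ[X]}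
    (hnn : ∀ t ∈ ν.support, 0 ≤ (M * A).eval t) {n : ℕ} {z : Fin n → ℂ} (hz : ∀ k, 0 < (z k).im)
    (hM : ∀ k, (M.map (algebraMap ℝ ℂ)).eval (z k) ≠ 0)
    (hf : ∀ k, f (z k) = (A.map (algebraMap ℝ ℂ)).eval (z k) /
      (M.map (algebraMap ℝ ℂ)).eval (z k) * g (z k)) :
    negSquares f z ≤ M.natDegree + A.natDegree + 1 := by
  have := hrep.finite
  set N := M.natDegree + A.natDegree + 1 with hN
  set Mc := M.map (algebraMap ℝ ℂ) with hMc
  set Ac := A.map (algebraMap ℝ ℂ) with hAc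
  -- The moment conditions on ξₖ = conj(vₖ)/M(zₖ) are antilinear in v; conjugating them gives a
  -- linear map.
  refine card_neg_eigenvalues_le _ (Matrix.mulVecLin (Matrix.of fun (i : Fin N) (k : Fin n) =>
    starRingEnd ℂ (z k ^ (i : ℕ) / Mc.eval (z k)))) fun v hv => ?_
  set ξ : Fin n → ℂ := fun k => starRingEnd ℂ (v k) / Mc.eval (z k) with hξd
  have hξ : ∀ i < N, ∑ j, ξ j * z j ^ i = 0 := by
    intro i hi
    have h1 := congrArg (starRingEnd ℂ) (congrFun hv ⟨i, hi⟩)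
    simp only [Matrix.mulVecLin_apply, Matrix.mulVec, dotProduct, Matrix.of_apply, map_sum, map_mul,
      Complex.conj_conj, Pi.zero_apply, map_zero] at h1
    rw [← h1]
    refine Finset.sum_congr rfl fun j _ => ?_
    simp only [hξd]
    ring
  have h1 := hrep.clearedForm_eq_integral hz hξ hN.ge
  have h2 : star v ⬝ᵥ pickMatrix f z *ᵥ v = clearedForm ξ (fun j => starRingEnd ℂ (ξ j)) z
      (fun j => starRingEnd ℂ (z j)) Mc Ac g := by
    simp only [clearedForm, dotProduct, Matrix.mulVec, Finset.mul_sum, pickMatrix, Matrix.of_apply]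
    refine Finset.sum_congr rfl fun k _ => Finset.sum_congr rfl fun j _ => ?_
    have hMk := hM k
    have hMj : starRingEnd ℂ (Mc.eval (z j)) ≠ 0 := by simpa using hM j
    rw [hf k, hf j, hMc, hAc, eval_map_conj, eval_map_conj, hrep.symm (hz j).ne', ← hMc, ← hAc]
    simp only [hξd, map_mul, map_div₀, Complex.conj_conj, Pi.star_apply, RCLike.star_def]
    field_simp
  rw [h2, h1, Complex.ofReal_re]
  refine integral_nonneg_of_ae ?_
  filter_upwards [Measure.support_mem_ae (μ := ν)] with t ht
  exact mul_nonneg (by positivity) (mul_nonneg (hnn t ht) (Complex.normSq_nonneg _))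

/-- Im g(z₀) = 0 forces b = 0 and ν = 0 by positivity of the Poisson kernel, so g is a constant.
This disposes of poles of T cancelled by zeros of g. -/
theorem eq_zero_of_apply_eq_zero (hrep : NevanlinnaRep g a b ν) {z₀ : ℂ} (hz₀ : 0 < z₀.im)
    (h0 : g z₀ = 0) : ∀ z : ℂ, z.im ≠ 0 → g z = 0 := by
  have := hrep.finite
  have h1 := hrep.im_eq hz₀.ne'
  rw [h0, Complex.zero_im, eq_comm, mul_eq_zero, or_iff_right hz₀.ne'] at h1
  have hp := poisson_nonneg (ν := ν) z₀
  have hb : b = 0 := by linarith [hrep.nonneg]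
  have hi : ∫ t : ℝ, (1 + t ^ 2) / Complex.normSq ((t : ℂ) - z₀) ∂ν = 0 := by
    linarith [hrep.nonneg]
  have hpos : ∀ t : ℝ, 0 < (1 + t ^ 2) / Complex.normSq ((t : ℂ) - z₀) := fun t =>
    div_pos (by positivity) (Complex.normSq_pos.2 (ofReal_sub_ne_zero hz₀.ne' t))
  rw [integral_eq_zero_iff_of_nonneg (fun t => (hpos t).le)
    (integrable_poissonKernel hz₀.ne' ν)] at hi
  have hν : ν = 0 := by
    rw [← Measure.measure_univ_eq_zero]
    refine measure_mono_null (fun t _ => ?_) (ae_iff.1 hi)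
    exact (hpos t).ne'
  subst hb hν
  have ha := hrep.eq z₀ hz₀.ne'
  intro z hz
  rw [hrep.eq z hz]
  simpa [h0, eq_comm] using ha

end NevanlinnaRep

/-! ### The two implications and the pole count -/

theorem negSquares_eq_zero_of_apply_eq_zero {f : ℂ → ℂ} {n : ℕ} {z : Fin n → ℂ}
    (hf : ∀ k, f (z k) = 0) : negSquares f z = 0 := by
  refine Nat.le_zero.1 (card_neg_eigenvalues_le (pickMatrix_isHermitian f z) 0 fun v _ => ?_)
  have : pickMatrix f z = 0 := by
    ext k j
    simp [pickMatrix, hf]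
  simp [this]

theorem IsGenNevanlinna.exists_of_bounded {f : ℂ → ℂ}
    (hf : MeromorphicOn f {z : ℂ | 0 < z.im}) (hex : ∃ z : ℂ, 0 < z.im ∧ AnalyticAt ℂ f z) {N : ℕ}
    (hN : ∀ n : ℕ, ∀ z : Fin n → ℂ, AdmissibleNodes f z → negSquares f z ≤ N) :
    ∃ κ, IsGenNevanlinna κ f := by
  set V : Set ℕ := {m | ∃ n : ℕ, 0 < n ∧ ∃ z : Fin n → ℂ, AdmissibleNodes f z ∧ negSquares f z = m}
  have hV : V.Nonempty := by
    obtain ⟨z, hz, hza⟩ := hex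
    exact ⟨_, 1, one_pos, fun _ => z, fun _ => ⟨hz, hza⟩, rfl⟩
  have hb : BddAbove V := by
    refine ⟨N, ?_⟩
    rintro m ⟨n, -, z, hz, rfl⟩
    exact hN n z hz
  exact ⟨sSup V, hf, fun n hn z hz => le_csSup hb ⟨n, hn, z, hz, rfl⟩, Nat.sSup_mem hV hb⟩

theorem IsPickNevanlinna.meromorphicOn_ratMul {g : ℂ → ℂ} (hg : IsPickNevanlinna g)
    (T : RatFunc ℝ) : MeromorphicOn (ratMul T g) {z : ℂ | 0 < z.im} := by
  intro z hz
  have hp : ∀ p : ℝ[X], AnalyticAt ℂ (fun z => p.eval₂ (algebraMap ℝ ℂ) z) z := by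
    intro p
    have := (AnalyticOnNhd.eval_polynomial (𝕜 := ℂ) (p.map (algebraMap ℝ ℂ))) z trivial
    simpa [Polynomial.eval_map] using this
  have hopen : IsOpen {z : ℂ | z.im ≠ 0} := isOpen_ne_fun Complex.continuous_im continuous_const
  have hga : AnalyticAt ℂ g z := hg.holomorphic.analyticAt (hopen.mem_nhds (ne_of_gt hz))
  exact ((hp _).meromorphicAt.div (hp _).meromorphicAt).mul hga.meromorphicAt

theorem IsPickNevanlinna.exists_analyticAt_ratMul {g : ℂ → ℂ} (hg : IsPickNevanlinna g)
    (T : RatFunc ℝ) : ∃ z : ℂ, 0 < z.im ∧ AnalyticAt ℂ (ratMul T g) z := by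
  have hT : T.denom.map (algebraMap ℝ ℂ) ≠ 0 := by
    simpa [Polynomial.map_eq_zero] using T.denom_ne_zero
  have hinf : {z : ℂ | 0 < z.im}.Infinite := by
    refine Set.infinite_of_injective_forall_mem (f := fun n : ℕ => ((n : ℂ) + 1) * Complex.I) ?_ ?_
    · intro m n hmn
      simpa using hmn
    · intro n
      have : (0 : ℝ) < n + 1 := by positivity
      simpa using this
  obtain ⟨z, hz, hz0⟩ := hinf.exists_notMem_finset (T.denom.map (algebraMap ℝ ℂ)).roots.toFinset
  have hopen : IsOpen {z : ℂ | z.im ≠ 0} := isOpen_ne_fun Complex.continuous_im continuous_const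
  refine ⟨z, hz, (RatFunc.analyticAt_eval T ?_).mul
    (hg.holomorphic.analyticAt (hopen.mem_nhds (ne_of_gt hz)))⟩
  intro h
  apply hz0
  rw [Multiset.mem_toFinset, mem_roots hT, IsRoot, eval_map, h]

/-- If `T` has a pole at `z` in the upper half-plane and `T g` is holomorphic there, then `g`
vanishes at `z`. -/
theorem apply_eq_zero_of_analyticAt_ratMul {g : ℂ → ℂ} {T : RatFunc ℝ} {z : ℂ}
    (hg : ContinuousAt g z) (hf : AnalyticAt ℂ (ratMul T g) z)
    (hz : T.denom.eval₂ (algebraMap ℝ ℂ) z = 0) : g z = 0 := by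
  have hT : T.denom.map (algebraMap ℝ ℂ) ≠ 0 := by
    simpa [Polynomial.map_eq_zero] using T.denom_ne_zero
  have hpc : ∀ p : ℝ[X], ContinuousAt (fun z => p.eval₂ (algebraMap ℝ ℂ) z) z := by
    intro p
    have := (p.map (algebraMap ℝ ℂ)).continuous.continuousAt (x := z)
    simpa [Polynomial.eval_map] using this
  have hne : ∀ᶠ x in 𝓝[≠] z, T.denom.eval₂ (algebraMap ℝ ℂ) x ≠ 0 := by
    have h1 : ((T.denom.map (algebraMap ℝ ℂ)).roots.toFinset : Set ℂ).Finite :=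
      Finset.finite_toSet _
    have h2 := h1.isClosed.isOpen_compl
    have h3 : ∀ᶠ x in 𝓝[≠] z, x ∉
        ((T.denom.map (algebraMap ℝ ℂ)).roots.toFinset : Set ℂ) \ {z} := by
      have h4 : IsOpen (((T.denom.map (algebraMap ℝ ℂ)).roots.toFinset : Set ℂ) \ {z})ᶜ :=
        (h1.subset Set.sdiff_subset).isClosed.isOpen_compl
      exact nhdsWithin_le_nhds (h4.mem_nhds (by simp))
    filter_upwards [h3, self_mem_nhdsWithin] with x hx hxz h
    refine hx ⟨?_, hxz⟩
    rw [Finset.mem_coe, Multiset.mem_toFinset, mem_roots hT, IsRoot, eval_map, h]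
  have h1 : Tendsto (fun x => T.denom.eval₂ (algebraMap ℝ ℂ) x * ratMul T g x) (𝓝[≠] z) (𝓝 0) := by
    have := ((hpc T.denom).mul hf.continuousAt).tendsto.mono_left
      (nhdsWithin_le_nhds (s := {z}ᶜ))
    rwa [Pi.mul_apply, hz, zero_mul] at this
  have h2 : Tendsto (fun x => T.num.eval₂ (algebraMap ℝ ℂ) x * g x) (𝓝[≠] z)
      (𝓝 (T.num.eval₂ (algebraMap ℝ ℂ) z * g z)) :=
    ((hpc T.num).mul hg).tendsto.mono_left nhdsWithin_le_nhds
  have h3 : T.num.eval₂ (algebraMap ℝ ℂ) z * g z = 0 := by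
    refine tendsto_nhds_unique (h2.congr' ?_) h1
    filter_upwards [hne] with x hx
    rw [ratMul, RatFunc.eval]
    field_simp
  refine (mul_eq_zero.1 h3).resolve_left fun h4 => ?_
  obtain ⟨u, v, huv⟩ := T.isCoprime_num_denom
  have := congrArg (eval₂ (algebraMap ℝ ℂ) z) huv
  simp [eval₂_add, eval₂_mul, h4, hz] at this

theorem exists_isGenNevanlinna_ratMul {g : ℂ → ℂ} (hg : IsPickNevanlinna g) {T : RatFunc ℝ}
    (hA : AnalyticRealExceptFinitelyManyPoles g (negSet T)) :
    ∃ κ : ℕ, IsGenNevanlinna κ (ratMul T g) := by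
  obtain ⟨S, hS, -, -, hSa⟩ := hA
  obtain ⟨a, b, ν, hrep⟩ := hg.exists_rep
  -- With M = qD and A = pD for T = p/q, the product pqD² vanishes on S; elsewhere it is negative
  -- only on I \ S, which misses supp ν.
  set D : ℝ[X] := ∏ s ∈ hS.toFinset, (X - C s) with hD
  have hDt : ∀ t, D.eval t = 0 ↔ t ∈ S := by
    intro t
    simp only [hD, eval_prod, Finset.prod_eq_zero_iff, eval_sub, eval_X, eval_C, sub_eq_zero,
      hS.mem_toFinset, exists_eq_right']
  have hDz : ∀ z : ℂ, z.im ≠ 0 → (D.map (algebraMap ℝ ℂ)).eval z ≠ 0 := by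
    intro z hz
    simp only [hD, Polynomial.map_prod, eval_prod, Finset.prod_ne_zero_iff, Polynomial.map_sub,
      map_X, map_C, eval_sub, eval_X, eval_C]
    intro s _
    rw [← neg_ne_zero, neg_sub]
    exact ofReal_sub_ne_zero hz s
  refine IsGenNevanlinna.exists_of_bounded (hg.meromorphicOn_ratMul T)
    (hg.exists_analyticAt_ratMul T) (N := (T.denom * D).natDegree + (T.num * D).natDegree + 1)
    fun n z hz => ?_
  -- If g has a zero in the upper half-plane then f = 0 at all nodes. Otherwise no pole of T can be
  -- cancelled, so admissible nodes avoid the zeros of the denominator.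
  by_cases hg0 : ∃ z₀ : ℂ, 0 < z₀.im ∧ g z₀ = 0
  · obtain ⟨z₀, hz₀, h0⟩ := hg0
    rw [negSquares_eq_zero_of_apply_eq_zero]
    · exact Nat.zero_le _
    · intro k
      rw [ratMul, hrep.eq_zero_of_apply_eq_zero hz₀ h0 _ (hz k).1.ne', mul_zero]
  have hopen : IsOpen {z : ℂ | z.im ≠ 0} := isOpen_ne_fun Complex.continuous_im continuous_const
  have hq : ∀ k, T.denom.eval₂ (algebraMap ℝ ℂ) (z k) ≠ 0 := by
    intro k hk
    refine hg0 ⟨z k, (hz k).1, apply_eq_zero_of_analyticAt_ratMul ?_ (hz k).2 hk⟩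
    exact (hg.holomorphic.differentiableAt (hopen.mem_nhds (hz k).1.ne')).continuousAt
  refine hrep.negSquares_le_of_eval_ne_zero (fun t ht => ?_) (fun k => (hz k).1) (fun k => ?_)
    (fun k => ?_)
  · by_contra hneg
    rw [not_le, eval_mul, eval_mul, eval_mul] at hneg
    have h1 : D.eval t ≠ 0 := by
      intro h0; rw [h0] at hneg; simp at hneg
    have h2 : T.denom.eval t ≠ 0 := by
      intro h0; rw [h0] at hneg; simp at hneg
    refine hrep.notMem_support_of_isAnalyticRealAt (hSa t ⟨⟨h2, ?_⟩, fun h => h1 ((hDt t).2 h)⟩) ht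
    rw [RatFunc.eval, eval₂_id, eval₂_id]
    have h3 : T.num.eval t * T.denom.eval t < 0 := by
      have h4 : T.denom.eval t * D.eval t * (T.num.eval t * D.eval t) =
        (T.num.eval t * T.denom.eval t) * D.eval t ^ 2 := by ring
      rw [h4] at hneg
      exact neg_of_mul_neg_left hneg (sq_nonneg _)
    have h5 : T.num.eval t / T.denom.eval t =
        T.num.eval t * T.denom.eval t / T.denom.eval t ^ 2 := by
      field_simp
    rw [h5]
    exact div_neg_of_neg_of_pos h3 (by positivity)
  · rw [Polynomial.map_mul, eval_mul, eval_map]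
    exact mul_ne_zero (hq k) (hDz _ (hz k).1.ne')
  · have h1 := hDz _ (hz k).1.ne'
    rw [Polynomial.map_mul, eval_mul, Polynomial.map_mul, eval_mul,
      mul_div_mul_right _ _ h1, eval_map, eval_map, ratMul, RatFunc.eval]

theorem analyticRealExceptFinitelyManyPoles_of_isGenNevanlinna {g : ℂ → ℂ}
    (hg : IsPickNevanlinna g) {T : RatFunc ℝ} {κ : ℕ} (hf : IsGenNevanlinna κ (ratMul T g)) :
    AnalyticRealExceptFinitelyManyPoles g (negSet T) := by
  obtain ⟨a, b, ν, hrep⟩ := hg.exists_rep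
  have hS : (negSet T ∩ ν.support).Finite :=
    Set.finite_of_encard_le_coe (hrep.encard_negSet_inter_support_le hg.holomorphic hf)
  have hopen : ∀ t ∈ negSet T, ∀ᶠ x in 𝓝 t, x ∈ negSet T := by
    intro t ht
    have h1 : ∀ᶠ x in 𝓝 t, T.denom.eval x ≠ 0 :=
      T.denom.continuous.continuousAt.eventually_ne ht.1
    have h2 : ContinuousAt (fun x => T.eval (RingHom.id ℝ) x) t := by
      simp only [RatFunc.eval, eval₂_id]
      exact T.num.continuous.continuousAt.div T.denom.continuous.continuousAt ht.1
    exact h1.and (h2.eventually_lt_const ht.2)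
  -- Finiteness of this set and openness of `negSet T` make its points isolated in supp ν.
  refine ⟨negSet T ∩ ν.support, hS, Set.inter_subset_left, fun t ht => ?_, fun t ht => ?_⟩
  · refine hrep.hasRealPoleAt_of_isolated ht.2 ?_
    have h1 : ∀ᶠ x in 𝓝 t, x ∉ (negSet T ∩ ν.support) \ {t} :=
      (hS.subset Set.sdiff_subset).isClosed.isOpen_compl.mem_nhds (by simp)
    filter_upwards [nhdsWithin_le_nhds h1, nhdsWithin_le_nhds (hopen t ht.1),
      self_mem_nhdsWithin] with x hx hx2 hxt hxs
    exact hx ⟨⟨hx2, hxs⟩, hxt⟩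
  · exact hrep.isAnalyticRealAt_of_notMem_support fun h => ht.2 ⟨ht.1, h⟩

theorem mainTheorem8 (g : ℂ → ℂ) (hg : IsPickNevanlinna g) (T : RatFunc ℝ) :
    ((∃ κ : ℕ, IsGenNevanlinna κ (ratMul T g)) ↔
      AnalyticRealExceptFinitelyManyPoles g (negSet T)) ∧
    ∀ κ : ℕ, IsGenNevanlinna κ (ratMul T g) →
      {t ∈ negSet T | HasRealPoleAt g t}.encard ≤ κ ∧
      {t ∈ negSet T | HasRealPoleAt (ratMul T g) t}.encard ≤ κ := by
  refine ⟨⟨fun ⟨κ, hκ⟩ => analyticRealExceptFinitelyManyPoles_of_isGenNevanlinna hg hκ,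
    exists_isGenNevanlinna_ratMul hg⟩, fun κ hκ => ?_⟩
  obtain ⟨a, b, ν, hrep⟩ := hg.exists_rep
  have hle := hrep.encard_negSet_inter_support_le hg.holomorphic hκ
  have h1 : {t ∈ negSet T | HasRealPoleAt g t} ⊆ negSet T ∩ ν.support := fun t ht =>
    ⟨ht.1, by_contra fun h =>
      ht.2.not_isAnalyticRealAt (hrep.isAnalyticRealAt_of_notMem_support h)⟩
  have h2 : {t ∈ negSet T | HasRealPoleAt (ratMul T g) t} ⊆ negSet T ∩ ν.support := fun t ht =>
    ⟨ht.1, by_contra fun h =>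
      (hrep.isAnalyticRealAt_of_notMem_support h).not_hasRealPoleAt_ratMul ht.1 ht.2⟩
  exact ⟨(Set.encard_le_encard h1).trans hle, (Set.encard_le_encard h2).trans hle⟩
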